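/- **Setting.** Let $\mathcal M=(\mathcal S,\mathcal A,P,r,\gamma,\rho)$ be a discounted Markov decision process with $\gamma\in(0,1)$, transition kernel $P(\cdot\mid s,a)$, reward $r(s,a)$ and initial distribution $\rho$, and let $\pi_\theta(a\mid s)$, $\theta\in\mathbb R^d$, be a parameterised policy (a probability mass function, or more generally a probability density with respect to a fixed $\sigma$-finite measure, on the actions). For a horizon $H$, let $p(\cdot\mid\pi_\theta)$ be the law of the trajectory $\tau=(s_0,a_0,\dots,s_{H-1},a_{H-1})$ with $s_0\sim\rho$, $a_h\sim\pi_\theta(\cdot\mid s_h)$, $s_{h+1}\sim P(\cdot\mid s_h,a_h)$. Put $$J(\theta)=\mathbb E_{\tau\sim p(\cdot\mid\pi_\theta)}\Big[\sum_{h=0}^{H-1}\gamma^h r(s_h,a_h)\Big],\qquad \Psi_h(\tau)=\sum_{t=h}^{H-1}\gamma^t r(s_t,a_t),\qquad \Phi(\theta;\tau)=\sum_{h=0}^{H-1}\Psi_h(\tau)\log\pi_\theta(a_h\mid s_h),$$ $$g(\tau;\theta)=\sum_{h=0}^{H-1}\Psi_h(\tau)\nabla_\theta\log\pi_\theta(a_h\mid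 s_h),\qquad B(\tau;\theta)=\nabla\Phi(\theta;\tau)\,\nabla\log p(\tau\mid\pi_\theta)^{\top}+\nabla^2\Phi(\theta;\tau).$$ **Assumptions.** (1) There is $R_0>0$ with $|r(s,a)|<R_0$ for all $s,a$. (2) For all $s,a$, $\log\pi_\theta(a\mid s)$ is defined and twice differentiable in $\theta$, and there are $G,L>0$ with $\|\nabla\log\pi_\theta(a\mid s)\|\le G$ and $\|\nabla^2\log\pi_\theta(a\mid s)\|\le L$ (operator norm) for all $\theta,s,a$. **Algorithm (SHARP).** Given $\theta_0\in\mathbb R^d$, $\alpha_0,\eta_0$ and $T\ge1$: sample $\tau_0\sim p(\cdot\mid\pi_{\theta_0})$, put $v_0=g(\tau_0;\theta_0)$ and $\theta_1=\theta_0+\eta_0v_0/\|v_0\|$. For $t=1,\dots,T-1$, sample $b_t$ uniformly on $[0,1]$ independently of the past, put $\theta_t^b=b_t\theta_t+(1-b_t)\theta_{t-1}$, sample $\tau_t\sim p(\cdot\mid\pi_{\theta_t})$ and $\tau_t^b\sim p(\cdot\mid\pi_{\theta_t^b})$ (independently, given the past and $b_t$), and put, with $\eta_t=\eta_0/t^{2/3}$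 and $\alpha_t=\alpha_0/t^{2/3}$, $$v_t=(1-\alpha_t)\big(v_{t-1}+B(\tau_t^b;\theta_t^b)(\theta_t-\theta_{t-1})\big)+\alpha_t\,g(\tau_t;\theta_t),\qquad \theta_{t+1}=\theta_t+\eta_t\frac{v_t}{\|v_t\|},$$ where $v/\|v\|$ is read as $0$ if $v=0$. **Theorem.** Under assumptions (1) and (2), for all $\alpha_0\in(2/3,1]$, $\eta_0>0$, $\theta_0\in\mathbb R^d$ and $T\ge1$, the function $J$ is differentiable, and the iterates of SHARP satisfy $$\mathbb E\Big[\frac1T\sum_{t=1}^T\|\nabla J(\theta_t)\|\Big]\le\frac{8\sqrt C+9C_J/\eta_0}{T^{1/3}}+\frac{6\sigma_B\eta_0}{T^{2/3}},$$ the random variable on the left being integrable, where $$C=\frac{3\alpha_0\big(48\sigma_B^2\eta_0^2/\alpha_0+(6\alpha_0+1/\alpha_0)\sigma_g^2\big)}{3\alpha_0-2},\quad C_J=\frac{R_0}{1-\gamma},\quad \sigma_g^2=\frac{G^2R_0^2}{(1-\gamma)^4},\quad \sigma_B^2=\frac{H^2G^4R_0^2+L^2R_0^2}{(1-\gamma)^4}$$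 with $\sigma_g,\sigma_B\ge0$. -/

import Mathlib

open MeasureTheory ProbabilityTheory
open scoped ENNReal

/-- A discounted MDP `(S, A, P, r, γ, ρ)`; the state and action spaces are arbitrary measurable
spaces (discrete or continuous). -/
structure MDP (S A : Type*) [MeasurableSpace S] [MeasurableSpace A] where
  /-- transition kernel `P(· | s, a)` -/
  P : Kernel (S × A) S
  markov_P : IsMarkovKernel P
  /-- reward `r(s, a)` -/
  r : S → A → ℝ
  measurable_r : Measurable fun x : S × A => r x.1 x.2
  /-- discount factor -/
  γ : ℝ
  γ_pos : 0 < γ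
  γ_lt_one : γ < 1
  /-- distribution of the starting state -/
  ρ : Measure S
  prob_ρ : IsProbabilityMeasure ρ

/-- A policy parameterised by `θ ∈ ℝᵈ`: for each `θ` and `s`, `dens θ s` is a probability density
on the actions with respect to the reference measure `ν` (the counting measure for discrete
actions, so that `dens θ s a` is then the probability of `a`). -/
structure ParamPolicy (S A : Type*) [MeasurableSpace S] [MeasurableSpace A]
    (d : ℕ) (ν : Measure A) where
  dens : EuclideanSpace ℝ (Fin d) → S → A → ℝ
  nonneg : ∀ θ s a, 0 ≤ dens θ s a
  measurable_dens :
    Measurable fun x : EuclideanSpace ℝ (Fin d) × S × A => dens x.1 x.2.1 x.2.2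
  lintegral_dens : ∀ θ s, ∫⁻ a, ENNReal.ofReal (dens θ s a) ∂ν = 1

/-- A trajectory `(s₀, a₀, …, s_{H-1}, a_{H-1})`. -/
abbrev Traj (S A : Type*) (H : ℕ) := Fin H → S × A

noncomputable section

namespace MDP

variable {S A : Type*} [MeasurableSpace S] [MeasurableSpace A] (M : MDP S A)

instance : IsMarkovKernel M.P := M.markov_P

instance : IsProbabilityMeasure M.ρ := M.prob_ρ

/-- Law of the state `s_n` given `(s₀, a₀, …, s_{n-1}, a_{n-1})`. -/
def stateKernel : (n : ℕ) → Kernel (Traj S A n) S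
  | 0 => Kernel.const _ M.ρ
  | n + 1 => M.P.comap (fun τ => τ (Fin.last n)) (measurable_pi_apply _)

/-- The measure `ρ(ds₀) ν(da₀) ∏_{h ≥ 1} P(ds_h | s_{h-1}, a_{h-1}) ν(da_h)` on trajectories,
with respect to which trajectory laws have densities. -/
def trajBase (ν : Measure A) : (n : ℕ) → Measure (Traj S A n)
  | 0 => Measure.dirac Fin.elim0
  | n + 1 => (trajBase ν n ⊗ₘ (M.stateKernel n ×ₖ Kernel.const _ ν)).map
      (fun x => (Fin.snoc x.1 x.2 : Traj S A (n + 1)))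

/-- Discounted cumulative reward `R(τ)` of a trajectory. -/
def ret {H : ℕ} (τ : Traj S A H) : ℝ :=
  ∑ h : Fin H, M.γ ^ (h : ℕ) * M.r (τ h).1 (τ h).2

/-- `Ψ_h(τ) = ∑_{t = h}^{H-1} γ^t r(s_t, a_t)`. -/
def rewardToGo {H : ℕ} (h : Fin H) (τ : Traj S A H) : ℝ :=
  ∑ t ∈ Finset.Ici h, M.γ ^ (t : ℕ) * M.r (τ t).1 (τ t).2

variable {d H : ℕ} {ν : Measure A} (pol : ParamPolicy S A d ν)

/-- `∏_h π_θ(a_h | s_h)`: the density of the trajectory with respect to `trajBase`. -/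
def trajDens (θ : EuclideanSpace ℝ (Fin d)) (τ : Traj S A H) : ℝ :=
  ∏ h : Fin H, pol.dens θ (τ h).1 (τ h).2

/-- The law `p(· | π_θ)` of a trajectory of length `H` under the policy `π_θ`. -/
def trajLaw (H : ℕ) (θ : EuclideanSpace ℝ (Fin d)) : Measure (Traj S A H) :=
  (M.trajBase ν H).withDensity fun τ => ENNReal.ofReal (trajDens pol θ τ)

/-- Expected return `J(θ)`. -/
def J (H : ℕ) (θ : EuclideanSpace ℝ (Fin d)) : ℝ :=
  ∫ τ, M.ret τ ∂(M.trajLaw pol H θ)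

/-- `Φ(θ; τ) = ∑_h Ψ_h(τ) log π_θ(a_h | s_h)`. -/
def Phi (τ : Traj S A H) (θ : EuclideanSpace ℝ (Fin d)) : ℝ :=
  ∑ h : Fin H, M.rewardToGo h τ * Real.log (pol.dens θ (τ h).1 (τ h).2)

/-- Gradient estimator `g(τ; θ) = ∑_h Ψ_h(τ) ∇ log π_θ(a_h | s_h)`. -/
def gradEst (τ : Traj S A H) (θ : EuclideanSpace ℝ (Fin d)) : EuclideanSpace ℝ (Fin d) :=
  ∑ h : Fin H, M.rewardToGo h τ •
    gradient (fun θ' => Real.log (pol.dens θ' (τ h).1 (τ h).2)) θ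

/-- Hessian estimator `B(τ; θ) = ∇Φ(θ; τ) (∇ log p(τ | π_θ))ᵀ + ∇²Φ(θ; τ)` as a linear map.
The initial and transition laws do not depend on `θ`, so `∇ log p` is the gradient of the logarithm
of the density `trajDens`. -/
def hessEst (τ : Traj S A H) (θ : EuclideanSpace ℝ (Fin d)) :
    EuclideanSpace ℝ (Fin d) →L[ℝ] EuclideanSpace ℝ (Fin d) :=
  (innerSL ℝ (gradient (fun θ' => Real.log (trajDens pol θ' τ)) θ)).smulRight
      (gradient (M.Phi pol τ) θ)
    + fderiv ℝ (gradient (M.Phi pol τ)) θ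

/-- Bounded reward with constant `R₀`. -/
def BoundedReward (R₀ : ℝ) : Prop := ∀ s a, |M.r s a| < R₀

/-- `σ_g`, with `σ_g² = G² R₀² / (1-γ)⁴`. -/
def sigmaG (R₀ G : ℝ) : ℝ := Real.sqrt (G ^ 2 * R₀ ^ 2 / (1 - M.γ) ^ 4)

/-- `σ_B`, with `σ_B² = (H² G⁴ R₀² + L² R₀²) / (1-γ)⁴`. -/
def sigmaB (H : ℕ) (R₀ G L : ℝ) : ℝ :=
  Real.sqrt (((H : ℝ) ^ 2 * G ^ 4 * R₀ ^ 2 + L ^ 2 * R₀ ^ 2) / (1 - M.γ) ^ 4)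

end MDP

/-- Regularity of the parameterisation: `log π_θ(a | s)` is defined and twice differentiable in `θ`,
with gradient bounded by `G` and Hessian bounded (in operator norm) by `L`. -/
structure ParamPolicy.Regular {S A : Type*} [MeasurableSpace S] [MeasurableSpace A]
    {d : ℕ} {ν : Measure A} (pol : ParamPolicy S A d ν) (G L : ℝ) : Prop where
  pos : ∀ θ s a, 0 < pol.dens θ s a
  differentiable : ∀ s a, Differentiable ℝ fun θ => Real.log (pol.dens θ s a)
  differentiable_gradient : ∀ s a,
    Differentiable ℝ (gradient fun θ => Real.log (pol.dens θ s a))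
  gradient_le : ∀ θ s a, ‖gradient (fun θ' => Real.log (pol.dens θ' s a)) θ‖ ≤ G
  hessian_le : ∀ θ s a,
    ‖fderiv ℝ (gradient fun θ' => Real.log (pol.dens θ' s a)) θ‖ ≤ L

/-- Learning rates `η_0 = η₀` and `η_t = η₀ / t^{2/3}` for `t ≥ 1`. -/
def sharpEta (η₀ : ℝ) (t : ℕ) : ℝ :=
  if t = 0 then η₀ else η₀ / (t : ℝ) ^ ((2 : ℝ) / 3)

/-- Momentum weights `α_t = α₀ / t^{2/3}` (used for `t ≥ 1` only). -/
def sharpAlpha (α₀ : ℝ) (t : ℕ) : ℝ := α₀ / (t : ℝ) ^ ((2 : ℝ) / 3)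

/-- The random variables `θ_t, v_t, b_t, τ_t, τ_t^b` on `(Ω, μ)` are a run of SHARP with `T`
iterations, horizon `H`, initial point `θ₀` and parameters `α₀, η₀`. `ℱ t` is the information
available after iteration `t`, for instance the history `σ(τ_0, b_1, τ_1, τ_1^b, …, b_t, τ_t, τ_t^b)`.
The vector `v / ‖v‖` is read as `0` for `v = 0`. -/
structure IsSharpRun {S A Ω : Type*} [MeasurableSpace S] [MeasurableSpace A]
    [mΩ : MeasurableSpace Ω] {d : ℕ} {ν : Measure A} (M : MDP S A) (pol : ParamPolicy S A d ν)
    (H T : ℕ) (θ₀ : EuclideanSpace ℝ (Fin d)) (α₀ η₀ : ℝ) (μ : Measure Ω) (ℱ : Filtration ℕ mΩ)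
    (θ v : ℕ → Ω → EuclideanSpace ℝ (Fin d)) (b : ℕ → Ω → ℝ) (τ τb : ℕ → Ω → Traj S A H) :
    Prop where
  measurable_traj : ∀ t, t < T → Measurable[ℱ t] (τ t)
  measurable_unif : ∀ t, 1 ≤ t → t < T → Measurable[ℱ t] (b t)
  measurable_trajb : ∀ t, 1 ≤ t → t < T → Measurable[ℱ t] (τb t)
  /-- initial point -/
  theta_zero : ∀ ω, θ 0 ω = θ₀
  /-- `τ_0` is sampled with the policy `π_{θ_0}` -/
  law_traj_zero : μ.map (τ 0) = M.trajLaw pol H θ₀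
  v_zero : ∀ ω, v 0 ω = M.gradEst pol (τ 0 ω) (θ 0 ω)
  /-- Conditionally on the past `ℱ (t-1)`: `b_t` is uniform on `[0,1]`, and given `b_t` also, `τ_t`
  and `τ_t^b` are independent with laws `p(· | π_{θ_t})` and `p(· | π_{θ_t^b})`, where
  `θ_t^b = b_t θ_t + (1 - b_t) θ_{t-1}`. -/
  sampling : ∀ t, 1 ≤ t → t < T → ∀ D : Set Ω, MeasurableSet[ℱ (t - 1)] D →
    ∀ f : ℝ × Traj S A H × Traj S A H → ℝ≥0∞, Measurable f →
      ∫⁻ ω in D, f (b t ω, τ t ω, τb t ω) ∂μ =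
        ∫⁻ ω in D, ∫⁻ u in Set.Icc (0 : ℝ) 1,
          ∫⁻ y, ∫⁻ y', f (u, y, y')
            ∂(M.trajLaw pol H (u • θ t ω + (1 - u) • θ (t - 1) ω))
            ∂(M.trajLaw pol H (θ t ω)) ∂volume ∂μ
  v_step : ∀ t, 1 ≤ t → t < T → ∀ ω,
    v t ω = (1 - sharpAlpha α₀ t) • (v (t - 1) ω +
        M.hessEst pol (τb t ω) (b t ω • θ t ω + (1 - b t ω) • θ (t - 1) ω)
          (θ t ω - θ (t - 1) ω))
      + sharpAlpha α₀ t • M.gradEst pol (τ t ω) (θ t ω)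
  theta_step : ∀ t, t < T → ∀ ω,
    θ (t + 1) ω = θ t ω + sharpEta η₀ t • (‖v t ω‖⁻¹ • v t ω)

/-- `C = 3α₀ (48 σ_B² η₀² / α₀ + (6α₀ + 1/α₀) σ_g²) / (3α₀ - 2)`. -/
def sharpC (α₀ η₀ σg σB : ℝ) : ℝ :=
  3 * α₀ * (48 * σB ^ 2 * η₀ ^ 2 / α₀ + (6 * α₀ + 1 / α₀) * σg ^ 2) / (3 * α₀ - 2)

end

/-!
A normalized step of length `η` in direction `v` raises `J` by at least
`η (‖∇J‖ - 2 ‖v - ∇J‖ - Kη)`, where `K` is a Lipschitz constant of `∇J`, so telescoping `J` along a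
run bounds the gradient norms by the errors `e_t = v_t - ∇J(θ_t)`. The policy gradient theorem makes
`g` unbiased for `∇J(θ)` and `B` unbiased for `∇²J(θ)`; evaluated at a uniform point of the segment
`[θ_{t-1}, θ_t]`, the vector `B (θ_t - θ_{t-1})` is unbiased for `∇J(θ_t) - ∇J(θ_{t-1})`. Hence
`e_t = (1 - α_t) e_{t-1} + ξ_t` with noise `ξ_t` centred given the past and bounded by
`2 (1 - α_t) σ_B ‖θ_t - θ_{t-1}‖ + α_t σ_g`. The steps have length at most `η_{t-1}`, so
`E ‖e_t‖²` satisfies a scalar recursion whose solution is at most `C / t^{2/3}`.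
-/

/-! ### Differentiation -/

section Measurability

variable {X E F : Type*} [MeasurableSpace X] [NormedAddCommGroup E] [NormedSpace ℝ E]
  [NormedAddCommGroup F] [NormedSpace ℝ F] [MeasurableSpace F] [BorelSpace F]
  [SecondCountableTopology F]

lemma stronglyMeasurable_clm_of_measurable_apply [FiniteDimensional ℝ E] {f : X → E →L[ℝ] F}
    (hf : ∀ w, Measurable fun x => f x w) : StronglyMeasurable f := by
  let e := Module.finBasis ℝ E
  have hsum : f = fun x => ∑ i, ContinuousLinearMap.smulRightL ℝ E F
      (LinearMap.toContinuousLinearMap (e.coord i)) (f x (e i)) := by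
    ext x w
    conv_lhs => rw [← e.sum_repr w, map_sum]
    simp
  rw [hsum]
  exact Finset.stronglyMeasurable_fun_sum _ fun i _ =>
    (ContinuousLinearMap.continuous _).comp_stronglyMeasurable (hf _).stronglyMeasurable

lemma stronglyMeasurable_of_hasFDerivAt [FiniteDimensional ℝ E] [MeasurableSpace E]
    [BorelSpace E] {f : X → E → F} {f' : X → E → E →L[ℝ] F}
    (hf : Measurable fun p : X × E => f p.1 p.2) (hf' : ∀ x e, HasFDerivAt (f x) (f' x e) e) :
    StronglyMeasurable fun p : X × E => f' p.1 p.2 := by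
  refine stronglyMeasurable_clm_of_measurable_apply fun w => ?_
  have hlim : ∀ p : X × E, Filter.Tendsto
      (fun n : ℕ => ((n : ℝ) + 1) • (f p.1 (p.2 + ((n : ℝ) + 1)⁻¹ • w) - f p.1 p.2))
      Filter.atTop (nhds (f' p.1 p.2 w)) := fun p =>
    (hf' p.1 p.2).lim w (Filter.tendsto_abs_atTop_atTop.comp
      (Filter.tendsto_atTop_add_const_right _ _ tendsto_natCast_atTop_atTop))
  refine measurable_of_tendsto_metrizable (fun n => ?_) (tendsto_pi_nhds.2 hlim)
  exact ((hf.comp (measurable_fst.prodMk (measurable_snd.add_const _))).sub hf).const_smul _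

end Measurability

section LogDerivative

variable {E : Type*} [NormedAddCommGroup E] [NormedSpace ℝ E] {f : E → ℝ} {s : E → E →L[ℝ] ℝ}

lemma hasFDerivAt_of_hasFDerivAt_log {θ : E} {s : E →L[ℝ] ℝ} (hpos : ∀ θ, 0 < f θ)
    (hs : HasFDerivAt (fun θ => Real.log (f θ)) s θ) : HasFDerivAt f (f θ • s) θ := by
  simpa only [Real.exp_log (hpos _)] using hs.exp

lemma le_exp_mul_of_hasFDerivAt_log {K : ℝ} (hpos : ∀ θ, 0 < f θ)
    (hs : ∀ θ, HasFDerivAt (fun θ => Real.log (f θ)) (s θ) θ) (hK : ∀ θ, ‖s θ‖ ≤ K) (θ θ' : E) :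
    f θ' ≤ Real.exp (K * ‖θ' - θ‖) * f θ := by
  have hlog : Real.log (f θ') - Real.log (f θ) ≤ K * ‖θ' - θ‖ :=
    (le_abs_self _).trans <| convex_univ.norm_image_sub_le_of_norm_hasFDerivWithin_le
      (fun x _ => (hs x).hasFDerivWithinAt) (fun x _ => hK x) (Set.mem_univ θ) (Set.mem_univ θ')
  rw [← Real.log_le_log_iff (hpos θ') (mul_pos (Real.exp_pos _) (hpos θ)),
    Real.log_mul (Real.exp_pos _).ne' (hpos θ).ne', Real.log_exp]
  linarith

/-- Writing `∇p = p ∇log p`, the derivative of `θ ↦ ∫ p θ F θ` is the integral of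
`p θ (∇log (p θ) F θ + ∇F θ)`. -/
theorem hasFDerivAt_integral_smul_of_log {X V : Type*} [MeasurableSpace X] {ξ : Measure X}
    [NormedAddCommGroup V] [NormedSpace ℝ V] {p : E → X → ℝ} {s : E → X → E →L[ℝ] ℝ}
    {F : E → X → V} {F' : E → X → E →L[ℝ] V} {K C C' : ℝ} (hpos : ∀ θ x, 0 < p θ x)
    (hp : ∀ θ, Integrable (p θ) ξ)
    (hs : ∀ θ x, HasFDerivAt (fun θ => Real.log (p θ x)) (s θ x) θ) (hK : ∀ θ x, ‖s θ x‖ ≤ K)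
    (hsm : ∀ θ, AEStronglyMeasurable (s θ) ξ) (hF : ∀ θ x, HasFDerivAt (F · x) (F' θ x) θ)
    (hFm : ∀ θ, AEStronglyMeasurable (F θ) ξ) (hF'm : ∀ θ, AEStronglyMeasurable (F' θ) ξ)
    (hC : ∀ θ x, ‖F θ x‖ ≤ C) (hC' : ∀ θ x, ‖F' θ x‖ ≤ C') (θ : E) :
    HasFDerivAt (fun θ => ∫ x, p θ x • F θ x ∂ξ)
      (∫ x, p θ x • ((s θ x).smulRight (F θ x) + F' θ x) ∂ξ) θ := by
  have hderiv : ∀ θ x, HasFDerivAt (fun θ => p θ x • F θ x)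
      (p θ x • ((s θ x).smulRight (F θ x) + F' θ x)) θ := fun θ x => by
    refine ((hasFDerivAt_of_hasFDerivAt_log (hpos · x) (hs θ x)).smul (hF θ x)).congr_fderiv ?_
    ext w
    simp [mul_smul, add_comm]
  have hbound : ∀ x, ∀ θ' ∈ Metric.ball θ 1,
      ‖p θ' x • ((s θ' x).smulRight (F θ' x) + F' θ' x)‖
        ≤ Real.exp |K| * p θ x * (K * C + C') := fun x θ' hθ' => by
    have hK0 : 0 ≤ K := (norm_nonneg _).trans (hK θ' x)
    have hexp : p θ' x ≤ Real.exp |K| * p θ x := by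
      refine (le_exp_mul_of_hasFDerivAt_log (hpos · x) (hs · x) (hK · x) θ θ').trans ?_
      have hθ : ‖θ' - θ‖ ≤ 1 := (mem_ball_iff_norm.1 hθ').le
      have := (hpos θ x).le
      gcongr
      exact (mul_le_of_le_one_right hK0 hθ).trans (le_abs_self K)
    rw [norm_smul, Real.norm_of_nonneg (hpos _ _).le]
    refine mul_le_mul hexp ((norm_add_le _ _).trans (add_le_add ?_ (hC' _ _))) (norm_nonneg _)
      (mul_nonneg (Real.exp_pos _).le (hpos _ _).le)
    rw [ContinuousLinearMap.norm_smulRight_apply]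
    exact mul_le_mul (hK _ _) (hC _ _) (norm_nonneg _) hK0
  refine hasFDerivAt_integral_of_dominated_of_fderiv_le (Metric.ball_mem_nhds θ one_pos)
    (Filter.Eventually.of_forall fun θ => (hp θ).aestronglyMeasurable.smul (hFm θ)) ?_ ?_
    (Filter.Eventually.of_forall hbound) (((hp θ).const_mul _).mul_const _)
    (Filter.Eventually.of_forall fun x θ' _ => hderiv θ' x)
  · exact (hp θ).smul_bdd C (hFm θ) (Filter.Eventually.of_forall (hC θ))
  · refine (hp θ).aestronglyMeasurable.smul (AEStronglyMeasurable.add ?_ (hF'm θ))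
    exact (ContinuousLinearMap.smulRightL ℝ E V).continuous₂.comp_aestronglyMeasurable
      ((hsm θ).prodMk (hFm θ))

end LogDerivative

lemma setIntegral_Icc_fderiv_segment {E F : Type*} [NormedAddCommGroup E] [NormedSpace ℝ E]
    [NormedAddCommGroup F] [NormedSpace ℝ F] [CompleteSpace F] {f : E → F} {f' : E → E →L[ℝ] F}
    {K : ℝ} (hf : ∀ x, HasFDerivAt f (f' x) x) (hK : ∀ x, ‖f' x‖ ≤ K) (x y : E) :
    ∫ u in Set.Icc (0 : ℝ) 1, f' (u • x + (1 - u) • y) (x - y) = f x - f y := by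
  have hline : ∀ u : ℝ, HasDerivAt (fun u : ℝ => u • x + (1 - u) • y) (x - y) u := fun u =>
    (((hasDerivAt_id u).smul_const x).fun_add
      (((hasDerivAt_id u).const_sub 1).smul_const y)).congr_deriv
      (by rw [one_smul, neg_one_smul, sub_eq_add_neg])
  have hderiv : ∀ u : ℝ, HasDerivAt (fun u : ℝ => f (u • x + (1 - u) • y))
      (f' (u • x + (1 - u) • y) (x - y)) u := fun u => (hf _).comp_hasDerivAt u (hline u)
  have hint : IntervalIntegrable (fun u : ℝ => f' (u • x + (1 - u) • y) (x - y)) volume 0 1 := by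
    rw [← funext fun u => (hderiv u).deriv, intervalIntegrable_iff,
      Set.uIoc_of_le zero_le_one]
    refine Integrable.of_bound (aestronglyMeasurable_deriv _ _) (K * ‖x - y‖)
      (Filter.Eventually.of_forall fun u => ?_)
    rw [(hderiv u).deriv]
    exact (f' _).le_of_opNorm_le (hK _) _
  rw [integral_Icc_eq_integral_Ioc, ← intervalIntegral.integral_of_le zero_le_one,
    intervalIntegral.integral_eq_sub_of_hasDerivAt (fun u _ => hderiv u) hint]
  simp

/-! ### Sums and recursions with power weights -/

section PowerWeights

variable {p : ℝ}

lemma rpow_le_rpow_add_mul_sub {x y : ℝ} (hp : 0 ≤ p) (hp' : p ≤ 1) (hx : 0 ≤ x) (hy : 0 < y) :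
    x ^ p ≤ y ^ p + p * y ^ (p - 1) * (x - y) := by
  have hxy : -1 ≤ (x - y) / y := by
    rw [sub_div, div_self hy.ne']
    linarith [div_nonneg hx hy.le]
  calc x ^ p = y ^ p * (1 + (x - y) / y) ^ p := by
        rw [← Real.mul_rpow hy.le (by linarith), mul_add, mul_div_cancel₀ _ hy.ne', mul_one,
          add_sub_cancel]
    _ ≤ y ^ p * (1 + p * ((x - y) / y)) := by
        gcongr
        exact rpow_one_add_le_one_add_mul_self hxy hp hp'
    _ = y ^ p + p * y ^ (p - 1) * (x - y) := by
        rw [Real.rpow_sub_one hy.ne']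
        ring

lemma sum_Icc_rpow_sub_one_le (hp : 0 < p) (hp' : p ≤ 1) (n : ℕ) :
    ∑ t ∈ Finset.Icc 1 n, (t : ℝ) ^ (p - 1) ≤ (n : ℝ) ^ p / p := by
  induction n with
  | zero => simp [Real.zero_rpow hp.ne']
  | succ n ih =>
    have htangent := rpow_le_rpow_add_mul_sub hp.le hp' n.cast_nonneg
      (by positivity : (0 : ℝ) < n + 1)
    rw [le_div_iff₀ hp] at ih ⊢
    rw [Finset.sum_Icc_succ_top (by omega), add_mul]
    push_cast
    linarith

lemma sum_Ico_rpow_sub_one_le (hp : 0 < p) (hp' : p ≤ 1) (n : ℕ) :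
    ∑ t ∈ Finset.Ico 1 n, (t : ℝ) ^ (p - 1) ≤ (n : ℝ) ^ p / p :=
  (Finset.sum_le_sum_of_subset_of_nonneg Finset.Ico_subset_Icc_self
    fun _ _ _ => by positivity).trans (sum_Icc_rpow_sub_one_le hp hp' n)

lemma sum_Ico_mul_sub_le {w f : ℕ → ℝ} {c : ℝ} (hw : Monotone w) (hw0 : ∀ t, 0 ≤ w t)
    (hf : ∀ t, |f t| ≤ c) {m n : ℕ} (hmn : m ≤ n) :
    ∑ t ∈ Finset.Ico m n, w t * (f (t + 1) - f t) ≤ 2 * c * w n := by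
  have hfc : ∀ t, 0 ≤ f t + c := fun t => by linarith [(abs_le.1 (hf t)).1]
  have habel : ∑ t ∈ Finset.Ico m n, w t * (f (t + 1) - f t) ≤ w n * (f n + c) := by
    induction n, hmn using Nat.le_induction with
    | base => simpa using mul_nonneg (hw0 m) (hfc m)
    | succ n hmn ih =>
      rw [Finset.sum_Ico_succ_top hmn]
      linarith [mul_le_mul_of_nonneg_right (hw n.le_succ) (hfc (n + 1))]
  linarith [mul_le_mul_of_nonneg_left (abs_le.1 (hf n)).2 (hw0 n)]

lemma le_div_rpow_of_recursion {a : ℕ → ℝ} {α C D : ℝ} {T : ℕ} (hp : 0 ≤ p) (hpα : p ≤ α)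
    (hα : α ≤ 1) (hC : 0 ≤ C) (hD : D ≤ C * (α - p)) (ha : a 1 ≤ C)
    (hstep : ∀ t : ℕ, 1 ≤ t → t + 1 < T →
      a (t + 1) ≤ (1 - α / (t + 1 : ℝ) ^ p) * a t + D / ((t + 1 : ℝ) ^ p) ^ 2)
    {t : ℕ} (ht : 1 ≤ t) (htT : t < T) : a t ≤ C / (t : ℝ) ^ p := by
  induction t, ht using Nat.le_induction with
  | base => simpa using ha
  | succ t ht ih =>
    have ht' : (1 : ℝ) ≤ t := by exact_mod_cast ht
    have hxy : ((t : ℝ) + 1) ^ p ≤ (t : ℝ) ^ p + p := by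
      refine (rpow_le_rpow_add_mul_sub hp (hpα.trans hα) (by positivity)
        (by positivity : (0 : ℝ) < t)).trans ?_
      rw [add_sub_cancel_left, mul_one]
      gcongr
      exact mul_le_of_le_one_right hp (Real.rpow_le_one_of_one_le_of_nonpos ht' (by linarith))
    have hy : 1 ≤ (t : ℝ) ^ p := Real.one_le_rpow ht' hp
    have hx : 1 ≤ ((t : ℝ) + 1) ^ p := Real.one_le_rpow (by linarith) hp
    have hstep := hstep t ht htT
    have ih := ih (by omega)
    push_cast
    set x := ((t : ℝ) + 1) ^ p
    set y := (t : ℝ) ^ p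
    have hαx : 0 ≤ 1 - α / x := sub_nonneg.2 ((div_le_one (by linarith)).2 (by linarith))
    have hquad : (x - α) * x + (α - p) * y ≤ x * y := by nlinarith
    calc a (t + 1) ≤ (1 - α / x) * (C / y) + C * (α - p) / x ^ 2 := by
          refine hstep.trans ?_
          gcongr
      _ = C * ((x - α) * x + (α - p) * y) / (x ^ 2 * y) := by field_simp
      _ ≤ C * (x * y) / (x ^ 2 * y) := by gcongr
      _ = C / x := by field_simp

end PowerWeights

/-! ### Normalized gradient steps -/

section NormalizedStep

open NNReal

variable {E : Type*} [NormedAddCommGroup E] [InnerProductSpace ℝ E]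

lemma norm_norm_inv_smul_le_one (v : E) : ‖‖v‖⁻¹ • v‖ ≤ 1 := by
  rw [norm_smul, norm_inv, norm_norm]
  exact inv_mul_le_one

lemma norm_sub_two_mul_norm_sub_le_inner (g v : E) :
    ‖g‖ - 2 * ‖v - g‖ ≤ inner ℝ g (‖v‖⁻¹ • v) := by
  have hinner : inner ℝ v (‖v‖⁻¹ • v) = ‖v‖ := by
    rw [real_inner_smul_right, real_inner_self_eq_norm_mul_norm, ← mul_assoc]
    exact inv_mul_mul_self ‖v‖
  have hcs : inner ℝ (v - g) (‖v‖⁻¹ • v) ≤ ‖v - g‖ :=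
    (real_inner_le_norm _ _).trans
      (mul_le_of_le_one_right (norm_nonneg _) (norm_norm_inv_smul_le_one v))
  rw [inner_sub_left, hinner] at hcs
  linarith [norm_sub_norm_le g v, norm_sub_rev g v]

variable [CompleteSpace E] {f : E → ℝ} {K : ℝ≥0}

lemma inner_gradient_sub_le (hf : Differentiable ℝ f) (hK : LipschitzWith K (gradient f))
    (x y : E) : inner ℝ (gradient f x) (y - x) ≤ f y - f x + K * ‖y - x‖ ^ 2 := by
  have hmv := (convex_closedBall x ‖y - x‖).norm_image_sub_le_of_norm_hasFDerivWithin_le'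
    (f := f) (C := K * ‖y - x‖) (φ := InnerProductSpace.toDual ℝ E (gradient f x))
    (fun z _ => (hf z).hasGradientAt.hasFDerivAt.hasFDerivWithinAt)
    (fun z hz => by
      rw [← map_sub, LinearIsometryEquiv.norm_map]
      exact (hK.norm_sub_le z x).trans
        (mul_le_mul_of_nonneg_left (mem_closedBall_iff_norm.1 hz) K.2))
    (Metric.mem_closedBall_self (norm_nonneg _)) (mem_closedBall_iff_norm.2 le_rfl)
  rw [InnerProductSpace.toDual_apply_apply, Real.norm_eq_abs] at hmv
  linarith [(abs_le.1 hmv).1]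

lemma norm_gradient_le_of_normalized_step (hf : Differentiable ℝ f)
    (hK : LipschitzWith K (gradient f)) {η : ℝ} (hη : 0 < η) (x v : E) :
    ‖gradient f x‖ ≤
      (f (x + η • (‖v‖⁻¹ • v)) - f x) / η + 2 * ‖v - gradient f x‖ + K * η := by
  have hdesc := inner_gradient_sub_le hf hK x (x + η • (‖v‖⁻¹ • v))
  rw [add_sub_cancel_left, real_inner_smul_right, norm_smul, Real.norm_of_nonneg hη.le] at hdesc
  have hstep : (η * ‖‖v‖⁻¹ • v‖) ^ 2 ≤ η ^ 2 := by
    gcongr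
    exact mul_le_of_le_one_right hη.le (norm_norm_inv_smul_le_one v)
  have hinner : inner ℝ (gradient f x) (‖v‖⁻¹ • v) ≤
      (f (x + η • (‖v‖⁻¹ • v)) - f x) / η + K * η := by
    rw [← mul_le_mul_iff_right₀ hη, mul_add, mul_div_cancel₀ _ hη.ne']
    nlinarith [mul_le_mul_of_nonneg_left hstep K.2]
  linarith [norm_sub_two_mul_norm_sub_le_inner (gradient f x) v]

theorem sum_Ico_norm_gradient_le_of_normalized_steps {c η₀ p : ℝ} {T : ℕ}
    {x v : ℕ → E} (hf : Differentiable ℝ f) (hK : LipschitzWith K (gradient f))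
    (hc : ∀ y, |f y| ≤ c) (hη₀ : 0 < η₀) (hp : 0 ≤ p) (hp' : p < 1) (hT : 1 ≤ T)
    (hx : ∀ t, 1 ≤ t → t < T → x (t + 1) = x t + (η₀ / (t : ℝ) ^ p) • (‖v t‖⁻¹ • v t)) :
    ∑ t ∈ Finset.Ico 1 T, ‖gradient f (x t)‖ ≤ 2 * c / η₀ * (T : ℝ) ^ p +
      2 * ∑ t ∈ Finset.Ico 1 T, ‖v t - gradient f (x t)‖ +
      K * η₀ * ((T : ℝ) ^ (1 - p) / (1 - p)) := by
  have hstep : ∀ t ∈ Finset.Ico 1 T, ‖gradient f (x t)‖ ≤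
      η₀⁻¹ * ((t : ℝ) ^ p * (f (x (t + 1)) - f (x t))) + 2 * ‖v t - gradient f (x t)‖ +
        K * η₀ * (t : ℝ) ^ (1 - p - 1) := by
    intro t ht
    obtain ⟨ht₁, htT⟩ := Finset.mem_Ico.1 ht
    have ht₀ : (0 : ℝ) < t := by exact_mod_cast ht₁
    refine (norm_gradient_le_of_normalized_step hf hK (div_pos hη₀ (Real.rpow_pos_of_pos ht₀ p))
      (x t) (v t)).trans (le_of_eq ?_)
    rw [← hx t ht₁ htT, sub_sub_cancel_left, Real.rpow_neg ht₀.le]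
    field_simp
  have hdescent := sum_Ico_mul_sub_le (f := fun t => f (x t)) (w := fun t : ℕ => (t : ℝ) ^ p)
    (fun m n hmn => Real.rpow_le_rpow m.cast_nonneg (Nat.cast_le.2 hmn) hp)
    (fun t => by positivity) (fun t => hc _) hT
  calc ∑ t ∈ Finset.Ico 1 T, ‖gradient f (x t)‖
      ≤ η₀⁻¹ * ∑ t ∈ Finset.Ico 1 T, (t : ℝ) ^ p * (f (x (t + 1)) - f (x t)) +
          2 * ∑ t ∈ Finset.Ico 1 T, ‖v t - gradient f (x t)‖ +
          K * η₀ * ∑ t ∈ Finset.Ico 1 T, (t : ℝ) ^ (1 - p - 1) := by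
        simp only [Finset.mul_sum, ← Finset.sum_add_distrib]
        exact Finset.sum_le_sum hstep
    _ ≤ η₀⁻¹ * (2 * c * (T : ℝ) ^ p) + 2 * ∑ t ∈ Finset.Ico 1 T, ‖v t - gradient f (x t)‖ +
          K * η₀ * ((T : ℝ) ^ (1 - p) / (1 - p)) := by
        gcongr
        exact sum_Ico_rpow_sub_one_le (by linarith) (by linarith) T
    _ = _ := by ring

end NormalizedStep

/-! ### Second moments of momentum updates -/

section SecondMoment

variable {E : Type*} [NormedAddCommGroup E]

lemma integral_norm_le_sqrt_integral_norm_sq {Ω : Type*} [MeasurableSpace Ω] {μ : Measure Ω}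
    [IsProbabilityMeasure μ] {f : Ω → E} (hf : MemLp f 2 μ) :
    ∫ ω, ‖f ω‖ ∂μ ≤ √(∫ ω, ‖f ω‖ ^ 2 ∂μ) := by
  refine Real.le_sqrt_of_sq_le (sub_nonneg.1 ?_)
  have hvar := variance_nonneg (fun ω => ‖f ω‖) μ
  rwa [variance_eq_sub hf.norm] at hvar

variable [InnerProductSpace ℝ E] [CompleteSpace E]

lemma integral_norm_add_sub_integral_sq_le {Y : Type*} [MeasurableSpace Y] {κ : Measure Y}
    [IsProbabilityMeasure κ] {Z : Y → E} {D : ℝ} (hZ : AEStronglyMeasurable Z κ)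
    (hD : ∀ y, ‖Z y‖ ≤ D) (u : E) :
    ∫ y, ‖u + (Z y - ∫ y, Z y ∂κ)‖ ^ 2 ∂κ ≤ ‖u‖ ^ 2 + D ^ 2 := by
  have hZi : Integrable Z κ := .of_bound hZ D (.of_forall hD)
  have hsq : Integrable (fun y => ‖Z y‖ ^ 2) κ :=
    .of_bound (hZ.norm.pow 2) (D ^ 2) (.of_forall fun y => by
      rw [Real.norm_of_nonneg (by positivity)]
      gcongr
      exact hD y)
  set c := u - ∫ y, Z y ∂κ with hc
  have hexpand : ∀ y, ‖u + (Z y - ∫ y, Z y ∂κ)‖ ^ 2 =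
      ‖Z y‖ ^ 2 + (2 * inner ℝ c (Z y) + ‖c‖ ^ 2) := fun y => by
    rw [show u + (Z y - ∫ y, Z y ∂κ) = c + Z y by rw [hc]; abel, norm_add_sq_real]
    ring
  have hinner : Integrable (fun y => 2 * inner ℝ c (Z y)) κ := (hZi.const_inner c).const_mul 2
  have hcu : ‖u‖ ^ 2 = ‖c‖ ^ 2 + 2 * inner ℝ c (∫ y, Z y ∂κ) + ‖∫ y, Z y ∂κ‖ ^ 2 := by
    rw [← norm_add_sq_real, hc, sub_add_cancel]
  calc ∫ y, ‖u + (Z y - ∫ y, Z y ∂κ)‖ ^ 2 ∂κ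
      = ∫ y, ‖Z y‖ ^ 2 ∂κ + (2 * inner ℝ c (∫ y, Z y ∂κ) + ‖c‖ ^ 2) := by
        simp_rw [hexpand]
        rw [integral_add hsq (hinner.fun_add (integrable_const _)),
          integral_add hinner (integrable_const _), integral_const_mul, integral_inner hZi]
        simp
    _ ≤ D ^ 2 + (2 * inner ℝ c (∫ y, Z y ∂κ) + ‖c‖ ^ 2) := by
        gcongr
        refine (integral_mono hsq (integrable_const (D ^ 2)) fun y => ?_).trans (by simp)
        exact pow_le_pow_left₀ (norm_nonneg _) (hD y) 2
    _ ≤ ‖u‖ ^ 2 + D ^ 2 := by linarith [sq_nonneg ‖∫ y, Z y ∂κ‖]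

/-- Conditionally on `w`, the noise `Z w - ∫ Z w` is centred, so its cross term with `u w`
vanishes. -/
lemma integral_compProd_norm_add_sub_integral_sq_le {W Y : Type*} [MeasurableSpace W]
    [MeasurableSpace Y] {ρ : Measure W} [IsProbabilityMeasure ρ] {κ : Kernel W Y}
    [IsMarkovKernel κ] {u : W → E} {Z : W × Y → E} {D : ℝ} (hu : MemLp u 2 ρ)
    (hZ : StronglyMeasurable Z) (hD : ∀ᵐ w ∂ρ, ∀ y, ‖Z (w, y)‖ ≤ D) :
    ∫ z, ‖u z.1 + (Z z - ∫ y, Z (z.1, y) ∂κ z.1)‖ ^ 2 ∂(ρ ⊗ₘ κ) ≤ ∫ w, ‖u w‖ ^ 2 ∂ρ + D ^ 2 := by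
  have hu2 : Integrable (fun w => ‖u w‖ ^ 2) ρ := hu.norm.integrable_sq
  have hmean : StronglyMeasurable fun w => ∫ y, Z (w, y) ∂κ w :=
    hZ.integral_kernel_prod_right'
  have hfst : (ρ ⊗ₘ κ).map Prod.fst = ρ := Measure.fst_compProd ρ κ
  have hufst : MemLp (fun z : W × Y => u z.1) 2 (ρ ⊗ₘ κ) :=
    hu.comp_measurePreserving ⟨measurable_fst, hfst⟩
  have hnoise : MemLp (fun z : W × Y => Z z - ∫ y, Z (z.1, y) ∂κ z.1) 2 (ρ ⊗ₘ κ) := by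
    refine .of_bound (hZ.sub (hmean.comp_measurable measurable_fst)).aestronglyMeasurable
      (D + D) ?_
    filter_upwards [(measurable_fst.quasiMeasurePreserving (ρ ⊗ₘ κ)).ae
      (hfst.symm ▸ hD : ∀ᵐ w ∂(ρ ⊗ₘ κ).map Prod.fst, ∀ y, ‖Z (w, y)‖ ≤ D)] with z hz
    refine (norm_sub_le _ _).trans (add_le_add (hz z.2) ?_)
    simpa using norm_integral_le_of_norm_le_const (.of_forall hz) (μ := κ z.1)
  have hint : Integrable (fun z : W × Y => ‖u z.1 + (Z z - ∫ y, Z (z.1, y) ∂κ z.1)‖ ^ 2)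
      (ρ ⊗ₘ κ) := (hufst.add hnoise).norm.integrable_sq
  rw [Measure.integral_compProd hint]
  calc ∫ w, ∫ y, ‖u w + (Z (w, y) - ∫ y, Z (w, y) ∂κ w)‖ ^ 2 ∂κ w ∂ρ
      ≤ ∫ w, (‖u w‖ ^ 2 + D ^ 2) ∂ρ := by
        refine integral_mono_ae hint.integral_compProd (hu2.add (integrable_const _)) ?_
        filter_upwards [hD] with w hw
        exact integral_norm_add_sub_integral_sq_le
          (hZ.comp_measurable measurable_prodMk_left).aestronglyMeasurable hw (u w)
    _ = ∫ w, ‖u w‖ ^ 2 ∂ρ + D ^ 2 := by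
        rw [integral_add hu2 (integrable_const _)]
        simp

theorem integral_norm_add_sub_integral_sq_le_of_map_eq_compProd {Ω W Y : Type*}
    [MeasurableSpace Ω] [MeasurableSpace W] [MeasurableSpace Y] {μ : Measure Ω}
    [IsProbabilityMeasure μ] {κ : Kernel W Y} [IsMarkovKernel κ] {V : Ω → W} {X : Ω → Y}
    (hV : Measurable V) (hX : Measurable X)
    (hlaw : μ.map (fun ω => (V ω, X ω)) = μ.map V ⊗ₘ κ) {u : W → E} {Z : W × Y → E} {D : ℝ}
    (hu : StronglyMeasurable u) (hu2 : MemLp (u ∘ V) 2 μ) (hZ : StronglyMeasurable Z)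
    (hD : ∀ᵐ w ∂μ.map V, ∀ y, ‖Z (w, y)‖ ≤ D) :
    ∫ ω, ‖u (V ω) + (Z (V ω, X ω) - ∫ y, Z (V ω, y) ∂κ (V ω))‖ ^ 2 ∂μ ≤
      ∫ ω, ‖u (V ω)‖ ^ 2 ∂μ + D ^ 2 := by
  have := Measure.isProbabilityMeasure_map (μ := μ) hV.aemeasurable
  have hu_map : MemLp u 2 (μ.map V) :=
    (memLp_map_measure_iff hu.aestronglyMeasurable hV.aemeasurable).2 hu2
  have hsq : StronglyMeasurable fun w => ‖u w‖ ^ 2 := hu.norm.pow 2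
  have hnoise : StronglyMeasurable fun z : W × Y => Z z - ∫ y, Z (z.1, y) ∂κ z.1 :=
    hZ.sub (hZ.integral_kernel_prod_right'.comp_measurable measurable_fst)
  have hsum : StronglyMeasurable fun z : W × Y =>
      ‖u z.1 + (Z z - ∫ y, Z (z.1, y) ∂κ z.1)‖ ^ 2 :=
    ((hu.comp_measurable measurable_fst).add hnoise).norm.pow 2
  calc ∫ ω, ‖u (V ω) + (Z (V ω, X ω) - ∫ y, Z (V ω, y) ∂κ (V ω))‖ ^ 2 ∂μ
      = ∫ z, ‖u z.1 + (Z z - ∫ y, Z (z.1, y) ∂κ z.1)‖ ^ 2 ∂(μ.map V ⊗ₘ κ) := by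
        rw [← hlaw, integral_map (hV.prodMk hX).aemeasurable hsum.aestronglyMeasurable]
    _ ≤ ∫ w, ‖u w‖ ^ 2 ∂(μ.map V) + D ^ 2 :=
        integral_compProd_norm_add_sub_integral_sq_le hu_map hZ hD
    _ = ∫ ω, ‖u (V ω)‖ ^ 2 ∂μ + D ^ 2 := by
        rw [integral_map hV.aemeasurable hsq.aestronglyMeasurable]

end SecondMoment

/-! ### Trajectory laws -/

namespace MDP

variable {S A : Type*} [MeasurableSpace S] [MeasurableSpace A] (M : MDP S A)

instance isMarkovKernel_stateKernel (n : ℕ) : IsMarkovKernel (M.stateKernel n) := by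
  cases n with
  | zero => unfold stateKernel; infer_instance
  | succ n => unfold stateKernel; infer_instance

variable {d H : ℕ} {ν : Measure A} (pol : ParamPolicy S A d ν)

instance sFinite_trajBase [SFinite ν] (n : ℕ) : SFinite (M.trajBase ν n) := by
  cases n with
  | zero => unfold trajBase; infer_instance
  | succ n => unfold trajBase; infer_instance

lemma measurable_snoc (n : ℕ) : Measurable
    (fun x : Traj S A n × (S × A) => (Fin.snoc x.1 x.2 : Traj S A (n + 1))) := by
  refine measurable_pi_lambda _ fun i => ?_
  refine Fin.lastCases ?_ (fun j => ?_) i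
  · simpa using measurable_snd
  · simpa [Function.comp_def] using (measurable_pi_apply j).comp measurable_fst

lemma measurable_init (n : ℕ) :
    Measurable (fun τ : Traj S A (n + 1) => (Fin.init τ : Traj S A n)) :=
  measurable_pi_lambda _ fun i => measurable_pi_apply i.castSucc

lemma measurable_trajDens_uncurry :
    Measurable fun x : EuclideanSpace ℝ (Fin d) × Traj S A H => trajDens pol x.1 x.2 := by
  unfold trajDens
  refine Finset.measurable_fun_prod _ fun h _ => ?_
  exact pol.measurable_dens.comp (measurable_fst.prodMk
    ((measurable_fst.comp ((measurable_pi_apply h).comp measurable_snd)).prodMk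
      (measurable_snd.comp ((measurable_pi_apply h).comp measurable_snd))))

lemma measurable_trajDens (θ : EuclideanSpace ℝ (Fin d)) :
    Measurable fun τ : Traj S A H => trajDens pol θ τ :=
  (measurable_trajDens_uncurry pol).comp (measurable_const.prodMk measurable_id)

lemma trajDens_nonneg (θ : EuclideanSpace ℝ (Fin d)) (τ : Traj S A H) : 0 ≤ trajDens pol θ τ :=
  Finset.prod_nonneg fun _ _ => pol.nonneg _ _ _

lemma trajDens_snoc (θ : EuclideanSpace ℝ (Fin d)) (τ : Traj S A H) (x : S × A) :
    trajDens pol θ (Fin.snoc τ x : Traj S A (H + 1)) = trajDens pol θ τ * pol.dens θ x.1 x.2 := by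
  simp [trajDens, Fin.prod_univ_castSucc]

lemma lintegral_trajLaw_succ_init [SFinite ν] (n : ℕ) (θ : EuclideanSpace ℝ (Fin d))
    {f : Traj S A n → ℝ≥0∞} (hf : Measurable f) :
    ∫⁻ τ, f (Fin.init τ) ∂(M.trajLaw pol (n + 1) θ) = ∫⁻ τ, f τ ∂(M.trajLaw pol n θ) := by
  have hm := (measurable_trajDens (H := n) pol θ).ennreal_ofReal
  have hm' := (measurable_trajDens (H := n + 1) pol θ).ennreal_ofReal
  have hfi : Measurable fun τ : Traj S A (n + 1) => f (Fin.init τ) := hf.comp (measurable_init n)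
  have hd : Measurable fun x : S × A => ENNReal.ofReal (pol.dens θ x.1 x.2) :=
    (pol.measurable_dens.comp (measurable_const.prodMk measurable_id)).ennreal_ofReal
  have hmass : ∀ τ : Traj S A n, ∫⁻ x, ENNReal.ofReal (pol.dens θ x.1 x.2)
      ∂((M.stateKernel n ×ₖ Kernel.const _ ν) τ) = 1 := by
    intro τ
    rw [Kernel.prod_apply, lintegral_prod _ hd.aemeasurable]
    simp [pol.lintegral_dens]
  unfold trajLaw
  rw [lintegral_withDensity_eq_lintegral_mul _ hm' hfi,
    lintegral_withDensity_eq_lintegral_mul _ hm hf]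
  conv_lhs => rw [trajBase]
  rw [lintegral_map (hm'.mul hfi) (measurable_snoc n)]
  refine (Measure.lintegral_compProd ((hm'.mul hfi).comp (measurable_snoc n))).trans ?_
  refine lintegral_congr fun τ => ?_
  simp only [Pi.mul_apply, Function.comp_apply, Fin.init_snoc, trajDens_snoc,
    ENNReal.ofReal_mul (trajDens_nonneg pol θ τ)]
  have hcomm (x : S × A) :
      ENNReal.ofReal (trajDens pol θ τ) * ENNReal.ofReal (pol.dens θ x.1 x.2) * f τ =
        (ENNReal.ofReal (trajDens pol θ τ) * f τ) * ENNReal.ofReal (pol.dens θ x.1 x.2) := by ring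
  simp only [hcomm]
  rw [lintegral_const_mul _ hd, hmass, mul_one]

lemma map_init_trajLaw [SFinite ν] (n : ℕ) (θ : EuclideanSpace ℝ (Fin d)) :
    (M.trajLaw pol (n + 1) θ).map (fun τ => (Fin.init τ : Traj S A n)) = M.trajLaw pol n θ := by
  refine Measure.ext_of_lintegral _ fun f hf => ?_
  rw [lintegral_map hf (measurable_init n), lintegral_trajLaw_succ_init M pol n θ hf]

lemma integral_trajLaw_succ_init [SFinite ν] {V : Type*} [NormedAddCommGroup V] [NormedSpace ℝ V]
    (n : ℕ) (θ : EuclideanSpace ℝ (Fin d)) {f : Traj S A n → V}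
    (hf : AEStronglyMeasurable f (M.trajLaw pol n θ)) :
    ∫ τ, f (Fin.init τ) ∂(M.trajLaw pol (n + 1) θ) = ∫ τ, f τ ∂(M.trajLaw pol n θ) := by
  rw [← map_init_trajLaw M pol n θ] at hf ⊢
  rw [integral_map (measurable_init n).aemeasurable hf]

instance isProbabilityMeasure_trajLaw [SFinite ν] (n : ℕ) (θ : EuclideanSpace ℝ (Fin d)) :
    IsProbabilityMeasure (M.trajLaw pol n θ) := by
  constructor
  induction n with
  | zero => simp [trajLaw, trajBase, trajDens]
  | succ n ih =>
    have := lintegral_trajLaw_succ_init M pol n θ (f := fun _ => 1) measurable_const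
    simpa [ih] using this

/-- The trajectory laws `p(· | π_θ)` bundled as a kernel from parameters to trajectories. -/
noncomputable def trajKernel [SFinite ν] (H : ℕ) :
    Kernel (EuclideanSpace ℝ (Fin d)) (Traj S A H) where
  toFun := M.trajLaw pol H
  measurable' := by
    refine Measure.measurable_of_measurable_coe _ fun s hs => ?_
    have hm := (measurable_trajDens_uncurry (H := H) pol).ennreal_ofReal
    simp only [trajLaw, withDensity_apply _ hs]
    exact Measurable.lintegral_prod_right' (ν := (M.trajBase ν H).restrict s) hm

lemma trajKernel_apply [SFinite ν] (θ : EuclideanSpace ℝ (Fin d)) :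
    M.trajKernel pol H θ = M.trajLaw pol H θ := rfl

instance isMarkovKernel_trajKernel [SFinite ν] : IsMarkovKernel (M.trajKernel pol H) :=
  ⟨fun θ => by rw [trajKernel_apply]; infer_instance⟩

end MDP

/-! ### Rewards -/

namespace MDP

variable {S A : Type*} [MeasurableSpace S] [MeasurableSpace A] (M : MDP S A) {H : ℕ} {R₀ : ℝ}

lemma measurable_reward (h : Fin H) : Measurable fun τ : Traj S A H => M.r (τ h).1 (τ h).2 :=
  M.measurable_r.comp (measurable_pi_apply h)

lemma measurable_ret : Measurable fun τ : Traj S A H => M.ret τ :=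
  Finset.measurable_fun_sum _ fun h _ => (M.measurable_reward h).const_mul _

lemma measurable_rewardToGo (h : Fin H) : Measurable fun τ : Traj S A H => M.rewardToGo h τ :=
  Finset.measurable_fun_sum _ fun h _ => (M.measurable_reward h).const_mul _

lemma sum_discount_le : ∑ h : Fin H, M.γ ^ (h : ℕ) ≤ 1 / (1 - M.γ) := by
  rw [Fin.sum_univ_eq_sum_range (fun i => M.γ ^ i), Finset.range_eq_Ico]
  simpa using geom_sum_Ico_le_of_lt_one (m := 0) (n := H) M.γ_pos.le M.γ_lt_one

lemma sum_Ici_discount_le (h : Fin H) :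
    ∑ t ∈ Finset.Ici h, M.γ ^ (t : ℕ) ≤ M.γ ^ (h : ℕ) / (1 - M.γ) := by
  have hIco : ∑ t ∈ Finset.Ici h, M.γ ^ (t : ℕ) = ∑ i ∈ Finset.Ico (h : ℕ) H, M.γ ^ i := by
    rw [← Fin.map_valEmbedding_Ici, Finset.sum_map]
    rfl
  exact hIco.trans_le (geom_sum_Ico_le_of_lt_one M.γ_pos.le M.γ_lt_one)

/-- The discounted reward `γ^H r(s_H, a_H)` of the last step, by which the returns of a trajectory
and of its initial segment differ. -/
def lastReward (τ : Traj S A (H + 1)) : ℝ :=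
  M.γ ^ H * M.r (τ (Fin.last H)).1 (τ (Fin.last H)).2

lemma measurable_lastReward : Measurable fun τ : Traj S A (H + 1) => M.lastReward τ :=
  (M.measurable_reward _).const_mul _

lemma ret_succ (τ : Traj S A (H + 1)) : M.ret τ = M.ret (Fin.init τ : Traj S A H) +
    M.lastReward τ := by
  simp [ret, lastReward, Fin.sum_univ_castSucc, Fin.init]

lemma rewardToGo_castSucc (h : Fin H) (τ : Traj S A (H + 1)) :
    M.rewardToGo h.castSucc τ = M.rewardToGo h (Fin.init τ : Traj S A H) + M.lastReward τ := by
  have hIci_castSucc : Finset.Ici h.castSucc = Finset.univ.filter (h.castSucc ≤ ·) := by ext; simp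
  have hIci : Finset.Ici h = Finset.univ.filter (h ≤ ·) := by ext; simp
  simp [rewardToGo, lastReward, hIci_castSucc, hIci, Finset.sum_filter, Fin.sum_univ_castSucc,
    Fin.init, Fin.le_last]

lemma rewardToGo_last (τ : Traj S A (H + 1)) : M.rewardToGo (Fin.last H) τ = M.lastReward τ := by
  have hIci : Finset.Ici (Fin.last H) = {Fin.last H} := by ext; simp [Fin.last_le_iff]
  simp [rewardToGo, lastReward, hIci]

variable {M}

lemma abs_discounted_reward_le (hr : M.BoundedReward R₀) (n : ℕ) (s : S) (a : A) :
    |M.γ ^ n * M.r s a| ≤ M.γ ^ n * |R₀| := by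
  rw [abs_mul, abs_of_nonneg (pow_nonneg M.γ_pos.le n)]
  exact mul_le_mul_of_nonneg_left ((hr s a).le.trans (le_abs_self R₀)) (pow_nonneg M.γ_pos.le n)

lemma abs_lastReward_le (hr : M.BoundedReward R₀) (τ : Traj S A (H + 1)) :
    |M.lastReward τ| ≤ M.γ ^ H * |R₀| :=
  abs_discounted_reward_le hr _ _ _

lemma abs_ret_le (hr : M.BoundedReward R₀) (τ : Traj S A H) : |M.ret τ| ≤ |R₀| / (1 - M.γ) := by
  calc |M.ret τ| ≤ ∑ h : Fin H, M.γ ^ (h : ℕ) * |R₀| :=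
        (Finset.abs_sum_le_sum_abs _ _).trans
          (Finset.sum_le_sum fun h _ => abs_discounted_reward_le hr _ _ _)
    _ = (∑ h : Fin H, M.γ ^ (h : ℕ)) * |R₀| := by rw [Finset.sum_mul]
    _ ≤ 1 / (1 - M.γ) * |R₀| := by gcongr; exact M.sum_discount_le
    _ = |R₀| / (1 - M.γ) := by ring

lemma abs_rewardToGo_le (hr : M.BoundedReward R₀) (h : Fin H) (τ : Traj S A H) :
    |M.rewardToGo h τ| ≤ M.γ ^ (h : ℕ) * (|R₀| / (1 - M.γ)) := by
  calc |M.rewardToGo h τ| ≤ ∑ t ∈ Finset.Ici h, M.γ ^ (t : ℕ) * |R₀| :=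
        (Finset.abs_sum_le_sum_abs _ _).trans
          (Finset.sum_le_sum fun h _ => abs_discounted_reward_le hr _ _ _)
    _ = (∑ t ∈ Finset.Ici h, M.γ ^ (t : ℕ)) * |R₀| := by rw [Finset.sum_mul]
    _ ≤ M.γ ^ (h : ℕ) / (1 - M.γ) * |R₀| := by gcongr; exact M.sum_Ici_discount_le h
    _ = M.γ ^ (h : ℕ) * (|R₀| / (1 - M.γ)) := by ring

lemma sum_abs_rewardToGo_le (hr : M.BoundedReward R₀) (τ : Traj S A H) :
    ∑ h, |M.rewardToGo h τ| ≤ |R₀| / (1 - M.γ) ^ 2 := by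
  have hγ : 0 < 1 - M.γ := sub_pos.2 M.γ_lt_one
  calc ∑ h, |M.rewardToGo h τ| ≤ ∑ h : Fin H, M.γ ^ (h : ℕ) * (|R₀| / (1 - M.γ)) :=
        Finset.sum_le_sum fun h _ => abs_rewardToGo_le hr h τ
    _ = (∑ h : Fin H, M.γ ^ (h : ℕ)) * (|R₀| / (1 - M.γ)) := by rw [Finset.sum_mul]
    _ ≤ 1 / (1 - M.γ) * (|R₀| / (1 - M.γ)) := by gcongr; exact M.sum_discount_le
    _ = |R₀| / (1 - M.γ) ^ 2 := by field_simp

end MDP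

/-! ### Scores and estimators -/

namespace ParamPolicy

variable {S A : Type*} [MeasurableSpace S] [MeasurableSpace A] {d : ℕ} {ν : Measure A}
  {G L : ℝ}

/-- The score `∇_θ log π_θ(a | s)` of the policy. -/
noncomputable def score (pol : ParamPolicy S A d ν) (s : S) (a : A)
    (θ : EuclideanSpace ℝ (Fin d)) : EuclideanSpace ℝ (Fin d) :=
  gradient (fun θ' => Real.log (pol.dens θ' s a)) θ

variable {pol : ParamPolicy S A d ν}

lemma Regular.hasGradientAt_log_dens (hpol : pol.Regular G L) (s : S) (a : A)
    (θ : EuclideanSpace ℝ (Fin d)) :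
    HasGradientAt (fun θ' => Real.log (pol.dens θ' s a)) (pol.score s a θ) θ :=
  (hpol.differentiable s a θ).hasGradientAt

lemma Regular.measurable_score (hpol : pol.Regular G L) :
    Measurable fun x : (S × A) × EuclideanSpace ℝ (Fin d) => pol.score x.1.1 x.1.2 x.2 :=
  ((InnerProductSpace.toDual ℝ (EuclideanSpace ℝ (Fin d))).symm.continuous.comp_stronglyMeasurable
    (stronglyMeasurable_of_hasFDerivAt
      (f := fun (x : S × A) θ => Real.log (pol.dens θ x.1 x.2))
      (pol.measurable_dens.comp measurable_swap).log
      fun x θ => (hpol.differentiable x.1 x.2 θ).hasFDerivAt)).measurable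

lemma Regular.measurable_score_traj {H : ℕ} (hpol : pol.Regular G L) (h : Fin H) :
    Measurable fun x : Traj S A H × EuclideanSpace ℝ (Fin d) =>
      pol.score (x.1 h).1 (x.1 h).2 x.2 := by
  have hx : Measurable fun x : Traj S A H × EuclideanSpace ℝ (Fin d) => (x.1 h, x.2) :=
    ((measurable_pi_apply h).comp measurable_fst).prodMk measurable_snd
  exact hpol.measurable_score.comp hx

end ParamPolicy

namespace MDP

variable {S A : Type*} [MeasurableSpace S] [MeasurableSpace A] {d H : ℕ} {ν : Measure A}
  {R₀ G L : ℝ}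

/-- The trajectory score `∇_θ log p(τ | π_θ)`, where the factors of `p` that do not depend on `θ`
are omitted. -/
noncomputable def trajScore (pol : ParamPolicy S A d ν) (τ : Traj S A H)
    (θ : EuclideanSpace ℝ (Fin d)) : EuclideanSpace ℝ (Fin d) :=
  gradient (fun θ' => Real.log (trajDens pol θ' τ)) θ

variable {pol : ParamPolicy S A d ν}

lemma trajDens_pos (hpol : pol.Regular G L) (θ : EuclideanSpace ℝ (Fin d)) (τ : Traj S A H) :
    0 < trajDens pol θ τ := Finset.prod_pos fun _ _ => hpol.pos _ _ _

lemma hasGradientAt_log_trajDens (hpol : pol.Regular G L) (τ : Traj S A H)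
    (θ : EuclideanSpace ℝ (Fin d)) : HasGradientAt (fun θ' => Real.log (trajDens pol θ' τ))
      (∑ h, pol.score (τ h).1 (τ h).2 θ) θ := by
  have hlog : (fun θ' => Real.log (trajDens pol θ' τ)) =
      fun θ' => ∑ h, Real.log (pol.dens θ' (τ h).1 (τ h).2) :=
    funext fun θ' => Real.log_prod fun h _ => (hpol.pos _ _ _).ne'
  rw [hlog, hasGradientAt_iff_hasFDerivAt, map_sum]
  exact HasFDerivAt.fun_sum fun h _ => (hpol.hasGradientAt_log_dens _ _ θ).hasFDerivAt

lemma trajScore_eq_sum (hpol : pol.Regular G L) (τ : Traj S A H) (θ : EuclideanSpace ℝ (Fin d)) :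
    trajScore pol τ θ = ∑ h, pol.score (τ h).1 (τ h).2 θ :=
  (hasGradientAt_log_trajDens hpol τ θ).gradient

lemma norm_trajScore_le (hpol : pol.Regular G L) (τ : Traj S A H)
    (θ : EuclideanSpace ℝ (Fin d)) : ‖trajScore pol τ θ‖ ≤ H * G := by
  rw [trajScore_eq_sum hpol]
  refine (norm_sum_le_of_le _ fun h _ => hpol.gradient_le θ _ _).trans ?_
  simp

lemma measurable_trajScore (hpol : pol.Regular G L) :
    Measurable fun x : Traj S A H × EuclideanSpace ℝ (Fin d) => trajScore pol x.1 x.2 := by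
  simp only [trajScore_eq_sum hpol]
  exact Finset.measurable_fun_sum _ fun h _ => hpol.measurable_score_traj h

lemma measurable_trajScore_left (hpol : pol.Regular G L) (θ : EuclideanSpace ℝ (Fin d)) :
    Measurable fun τ : Traj S A H => trajScore pol τ θ :=
  Measurable.of_uncurry_right (f := trajScore pol) (measurable_trajScore hpol)

variable (M : MDP S A)

lemma hasGradientAt_Phi (hpol : pol.Regular G L) (τ : Traj S A H)
    (θ : EuclideanSpace ℝ (Fin d)) : HasGradientAt (M.Phi pol τ) (M.gradEst pol τ θ) θ := by
  unfold Phi gradEst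
  rw [hasGradientAt_iff_hasFDerivAt, map_sum]
  refine HasFDerivAt.fun_sum fun h _ => ?_
  rw [map_smul]
  exact (hpol.hasGradientAt_log_dens _ _ θ).hasFDerivAt.const_mul _

lemma hasFDerivAt_gradEst (hpol : pol.Regular G L) (τ : Traj S A H)
    (θ : EuclideanSpace ℝ (Fin d)) : HasFDerivAt (M.gradEst pol τ)
      (∑ h, M.rewardToGo h τ • fderiv ℝ (pol.score (τ h).1 (τ h).2) θ) θ :=
  HasFDerivAt.fun_sum fun _ _ =>
    (hpol.differentiable_gradient _ _ θ).hasFDerivAt.fun_const_smul _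

lemma differentiable_gradEst (hpol : pol.Regular G L) (τ : Traj S A H) :
    Differentiable ℝ (M.gradEst pol τ) :=
  fun θ => (M.hasFDerivAt_gradEst hpol τ θ).differentiableAt

lemma hessEst_eq (hpol : pol.Regular G L) (τ : Traj S A H) (θ : EuclideanSpace ℝ (Fin d)) :
    M.hessEst pol τ θ = (innerSL ℝ (trajScore pol τ θ)).smulRight (M.gradEst pol τ θ)
      + fderiv ℝ (M.gradEst pol τ) θ := by
  rw [hessEst, gradient_eq (M.hasGradientAt_Phi hpol τ), trajScore]

lemma gradEst_succ (hpol : pol.Regular G L) (τ : Traj S A (H + 1))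
    (θ : EuclideanSpace ℝ (Fin d)) :
    M.gradEst pol τ θ = M.gradEst pol (Fin.init τ : Traj S A H) θ +
      M.lastReward τ • trajScore pol τ θ := by
  rw [trajScore_eq_sum hpol]
  simp only [gradEst, Fin.sum_univ_castSucc, rewardToGo_castSucc, rewardToGo_last, add_smul,
    smul_add, Finset.sum_add_distrib, Finset.smul_sum, add_assoc]
  rfl

lemma measurable_gradEst (hpol : pol.Regular G L) :
    Measurable fun x : Traj S A H × EuclideanSpace ℝ (Fin d) => M.gradEst pol x.1 x.2 :=
  Finset.measurable_fun_sum _ fun h _ =>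
    ((M.measurable_rewardToGo h).comp measurable_fst).smul (hpol.measurable_score_traj h)

lemma measurable_gradEst_left (hpol : pol.Regular G L) (θ : EuclideanSpace ℝ (Fin d)) :
    Measurable fun τ : Traj S A H => M.gradEst pol τ θ :=
  Measurable.of_uncurry_right (f := M.gradEst pol) (M.measurable_gradEst hpol)

lemma stronglyMeasurable_fderiv_gradEst (hpol : pol.Regular G L) :
    StronglyMeasurable fun x : Traj S A H × EuclideanSpace ℝ (Fin d) =>
      fderiv ℝ (M.gradEst pol x.1) x.2 :=
  stronglyMeasurable_of_hasFDerivAt (M.measurable_gradEst hpol)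
    fun τ θ => (M.differentiable_gradEst hpol τ θ).hasFDerivAt

lemma stronglyMeasurable_hessEst (hpol : pol.Regular G L) :
    StronglyMeasurable fun x : Traj S A H × EuclideanSpace ℝ (Fin d) =>
      M.hessEst pol x.1 x.2 := by
  simp only [M.hessEst_eq hpol]
  refine StronglyMeasurable.add ?_ (M.stronglyMeasurable_fderiv_gradEst hpol)
  exact (ContinuousLinearMap.smulRightL ℝ _ _).continuous₂.comp_stronglyMeasurable
    (((innerSL ℝ).continuous.comp_stronglyMeasurable
      (measurable_trajScore hpol).stronglyMeasurable).prodMk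
      (M.measurable_gradEst hpol).stronglyMeasurable)

variable {M}

lemma norm_sum_rewardToGo_smul_le {V : Type*} [SeminormedAddCommGroup V] [NormedSpace ℝ V]
    {x : Fin H → V} {K : ℝ} (hr : M.BoundedReward R₀) (hx : ∀ h, ‖x h‖ ≤ K) (τ : Traj S A H) :
    ‖∑ h, M.rewardToGo h τ • x h‖ ≤ |R₀| / (1 - M.γ) ^ 2 * |K| := by
  calc ‖∑ h, M.rewardToGo h τ • x h‖ ≤ ∑ h, |M.rewardToGo h τ| * |K| :=
        norm_sum_le_of_le _ fun h _ => by
          rw [norm_smul, Real.norm_eq_abs]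
          gcongr
          exact (hx h).trans (le_abs_self K)
    _ ≤ |R₀| / (1 - M.γ) ^ 2 * |K| := by
        rw [← Finset.sum_mul]
        gcongr
        exact sum_abs_rewardToGo_le hr τ

lemma norm_gradEst_le (hr : M.BoundedReward R₀) (hpol : pol.Regular G L) (τ : Traj S A H)
    (θ : EuclideanSpace ℝ (Fin d)) : ‖M.gradEst pol τ θ‖ ≤ M.sigmaG R₀ G := by
  refine (norm_sum_rewardToGo_smul_le hr (fun h => hpol.gradient_le θ _ _) τ).trans
    (Real.le_sqrt_of_sq_le (le_of_eq ?_))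
  rw [mul_pow, div_pow, sq_abs, sq_abs]
  ring

lemma norm_fderiv_gradEst_le (hr : M.BoundedReward R₀) (hpol : pol.Regular G L) (τ : Traj S A H)
    (θ : EuclideanSpace ℝ (Fin d)) :
    ‖fderiv ℝ (M.gradEst pol τ) θ‖ ≤ M.sigmaB H R₀ G L := by
  rw [(M.hasFDerivAt_gradEst hpol τ θ).fderiv]
  refine (norm_sum_rewardToGo_smul_le hr (fun h => hpol.hessian_le θ _ _) τ).trans
    (Real.le_sqrt_of_sq_le ?_)
  rw [mul_pow, div_pow, sq_abs, sq_abs, ← pow_mul, div_mul_eq_mul_div]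
  refine div_le_div_of_nonneg_right ?_ ((even_two_mul 2).pow_nonneg _)
  linarith [show 0 ≤ (H : ℝ) ^ 2 * G ^ 4 * R₀ ^ 2 by positivity]

lemma mul_sigmaG_le_sigmaB : H * G * M.sigmaG R₀ G ≤ M.sigmaB H R₀ G L := by
  refine Real.le_sqrt_of_sq_le ?_
  rw [mul_pow, sigmaG, Real.sq_sqrt (by positivity), ← mul_div_assoc]
  gcongr
  linarith [show 0 ≤ L ^ 2 * R₀ ^ 2 by positivity]

lemma norm_hessEst_le (hr : M.BoundedReward R₀) (hpol : pol.Regular G L) (τ : Traj S A H)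
    (θ : EuclideanSpace ℝ (Fin d)) : ‖M.hessEst pol τ θ‖ ≤ 2 * M.sigmaB H R₀ G L := by
  rw [M.hessEst_eq hpol, two_mul]
  refine norm_add_le_of_le ?_ (norm_fderiv_gradEst_le hr hpol τ θ)
  rw [ContinuousLinearMap.norm_smulRight_apply, innerSL_apply_norm]
  exact (mul_le_mul (norm_trajScore_le hpol τ θ) (norm_gradEst_le hr hpol τ θ) (norm_nonneg _)
    ((norm_nonneg _).trans (norm_trajScore_le hpol τ θ))).trans mul_sigmaG_le_sigmaB

end MDP

/-! ### Policy gradient and policy Hessian -/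

namespace MDP

variable {S A : Type*} [MeasurableSpace S] [MeasurableSpace A] (M : MDP S A) {d H : ℕ}
  {ν : Measure A} {pol : ParamPolicy S A d ν} {R₀ G L : ℝ}

lemma integral_trajLaw {V : Type*} [NormedAddCommGroup V] [NormedSpace ℝ V]
    (f : Traj S A H → V) (θ : EuclideanSpace ℝ (Fin d)) :
    ∫ τ, f τ ∂(M.trajLaw pol H θ) = ∫ τ, trajDens pol θ τ • f τ ∂(M.trajBase ν H) := by
  rw [trajLaw, integral_withDensity_eq_integral_toReal_smul
    (measurable_trajDens pol θ).ennreal_ofReal (by simp)]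
  simp only [ENNReal.toReal_ofReal (trajDens_nonneg pol θ _)]

variable [SFinite ν]

lemma integrable_trajDens (θ : EuclideanSpace ℝ (Fin d)) :
    Integrable (fun τ : Traj S A H => trajDens pol θ τ) (M.trajBase ν H) := by
  refine ⟨(measurable_trajDens pol θ).aestronglyMeasurable, ?_⟩
  have hone : ∫⁻ τ, ENNReal.ofReal (trajDens pol θ τ) ∂(M.trajBase ν H) = 1 := by
    simpa [trajLaw] using measure_univ (μ := M.trajLaw pol H θ)
  rw [hasFiniteIntegral_iff_ofReal (Filter.Eventually.of_forall (trajDens_nonneg pol θ)), hone]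
  exact ENNReal.one_lt_top

theorem hasFDerivAt_integral_trajLaw {V : Type*} [NormedAddCommGroup V] [NormedSpace ℝ V]
    {F : Traj S A H → EuclideanSpace ℝ (Fin d) → V}
    {F' : Traj S A H → EuclideanSpace ℝ (Fin d) → EuclideanSpace ℝ (Fin d) →L[ℝ] V} {C C' : ℝ}
    (hpol : pol.Regular G L) (hF : ∀ τ θ, HasFDerivAt (F τ) (F' τ θ) θ)
    (hFm : ∀ θ, StronglyMeasurable fun τ => F τ θ)
    (hF'm : ∀ θ, StronglyMeasurable fun τ => F' τ θ)
    (hC : ∀ τ θ, ‖F τ θ‖ ≤ C) (hC' : ∀ τ θ, ‖F' τ θ‖ ≤ C') (θ : EuclideanSpace ℝ (Fin d)) :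
    HasFDerivAt (fun θ => ∫ τ, F τ θ ∂(M.trajLaw pol H θ))
      (∫ τ, ((innerSL ℝ (trajScore pol τ θ)).smulRight (F τ θ) + F' τ θ)
        ∂(M.trajLaw pol H θ)) θ := by
  simp only [integral_trajLaw]
  refine hasFDerivAt_integral_smul_of_log (s := fun θ τ => innerSL ℝ (trajScore pol τ θ))
    (F := fun θ τ => F τ θ) (F' := fun θ τ => F' τ θ) (K := H * G) (trajDens_pos hpol)
    M.integrable_trajDens (fun θ τ => ?_) (fun θ τ => ?_) (fun θ => ?_) (fun θ τ => hF τ θ)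
    (fun θ => (hFm θ).aestronglyMeasurable) (fun θ => (hF'm θ).aestronglyMeasurable)
    (fun θ τ => hC τ θ) (fun θ τ => hC' τ θ) θ
  · exact (hasGradientAt_log_trajDens hpol τ θ).differentiableAt.hasGradientAt.hasFDerivAt
  · rw [innerSL_apply_norm]
    exact norm_trajScore_le hpol τ θ
  · exact (innerSL ℝ).continuous.comp_aestronglyMeasurable
      (measurable_trajScore_left hpol θ).aestronglyMeasurable

lemma integrable_smul_trajScore {f : Traj S A H → ℝ} {C : ℝ} (hpol : pol.Regular G L)
    (hf : Measurable f) (hC : ∀ τ, |f τ| ≤ C) (θ : EuclideanSpace ℝ (Fin d)) :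
    Integrable (fun τ => f τ • trajScore pol τ θ) (M.trajLaw pol H θ) := by
  refine Integrable.of_bound (hf.smul (measurable_trajScore_left hpol θ)).aestronglyMeasurable
    (C * (H * G)) (Filter.Eventually.of_forall fun τ => ?_)
  rw [norm_smul]
  exact mul_le_mul (hC τ) (norm_trajScore_le hpol τ θ) (norm_nonneg _)
    ((abs_nonneg _).trans (hC τ))

theorem hasGradientAt_integral_trajLaw {f : Traj S A H → ℝ} {C : ℝ} (hpol : pol.Regular G L)
    (hf : Measurable f) (hC : ∀ τ, |f τ| ≤ C) (θ : EuclideanSpace ℝ (Fin d)) :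
    HasGradientAt (fun θ => ∫ τ, f τ ∂(M.trajLaw pol H θ))
      (∫ τ, f τ • trajScore pol τ θ ∂(M.trajLaw pol H θ)) θ := by
  have hderiv := M.hasFDerivAt_integral_trajLaw (F := fun τ _ => f τ) (F' := fun _ _ => 0) hpol
    (fun τ θ => hasFDerivAt_const _ _) (fun _ => hf.stronglyMeasurable)
    (fun _ => stronglyMeasurable_const) (fun τ _ => hC τ) (fun _ _ => norm_zero.le) θ
  refine hasGradientAt_iff_hasFDerivAt.2 (hderiv.congr_fderiv ?_)
  refine Eq.trans ?_
    ((innerSL ℝ).integral_comp_comm (M.integrable_smul_trajScore hpol hf hC θ))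
  congr with τ w
  simp only [add_zero, ContinuousLinearMap.smulRight_apply, smul_eq_mul, map_smul, smul_apply,
    mul_comm]

variable {M}

lemma integrable_gradEst (hr : M.BoundedReward R₀) (hpol : pol.Regular G L)
    (θ θ' : EuclideanSpace ℝ (Fin d)) :
    Integrable (fun τ => M.gradEst pol τ θ) (M.trajLaw pol H θ') :=
  Integrable.of_bound (M.measurable_gradEst_left hpol θ).aestronglyMeasurable _
    (Filter.Eventually.of_forall fun τ => norm_gradEst_le hr hpol τ θ)

lemma J_succ (hr : M.BoundedReward R₀) (θ : EuclideanSpace ℝ (Fin d)) :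
    M.J pol (H + 1) θ = M.J pol H θ + ∫ τ, M.lastReward τ ∂(M.trajLaw pol (H + 1) θ) := by
  have hret : Measurable fun τ : Traj S A H => M.ret τ := M.measurable_ret
  simp only [J, ret_succ]
  rw [integral_add, integral_trajLaw_succ_init M pol H θ hret.aestronglyMeasurable]
  · exact Integrable.of_bound (hret.comp (measurable_init H)).aestronglyMeasurable _
      (Filter.Eventually.of_forall fun τ => abs_ret_le hr _)
  · exact Integrable.of_bound M.measurable_lastReward.aestronglyMeasurable _
      (Filter.Eventually.of_forall (abs_lastReward_le hr))

lemma integral_gradEst_succ (hr : M.BoundedReward R₀) (hpol : pol.Regular G L)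
    (θ : EuclideanSpace ℝ (Fin d)) :
    ∫ τ, M.gradEst pol τ θ ∂(M.trajLaw pol (H + 1) θ) =
      (∫ τ, M.gradEst pol τ θ ∂(M.trajLaw pol H θ)) +
        ∫ τ, M.lastReward τ • trajScore pol τ θ ∂(M.trajLaw pol (H + 1) θ) := by
  have hg := integrable_gradEst (H := H) hr hpol θ θ
  have hgi : Integrable (fun τ : Traj S A (H + 1) => M.gradEst pol (Fin.init τ : Traj S A H) θ)
      (M.trajLaw pol (H + 1) θ) :=
    ((M.map_init_trajLaw pol H θ).symm ▸ hg).comp_measurable (measurable_init H)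
  rw [← integral_trajLaw_succ_init M pol H θ hg.aestronglyMeasurable, ← integral_add hgi
    (M.integrable_smul_trajScore hpol M.measurable_lastReward (abs_lastReward_le hr) θ)]
  simp only [M.gradEst_succ hpol]

theorem hasGradientAt_J (hr : M.BoundedReward R₀) (hpol : pol.Regular G L)
    (θ : EuclideanSpace ℝ (Fin d)) :
    HasGradientAt (M.J pol H) (∫ τ, M.gradEst pol τ θ ∂(M.trajLaw pol H θ)) θ := by
  induction H with
  | zero =>
    have hJ : M.J pol 0 = fun _ => 0 := by funext; simp [J, ret]
    simpa [hJ, gradEst] using hasGradientAt_const θ (0 : ℝ)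
  | succ H ih =>
    have hlast := M.hasGradientAt_integral_trajLaw hpol (M.measurable_lastReward (H := H))
      (abs_lastReward_le hr) θ
    rw [funext (J_succ hr), integral_gradEst_succ hr hpol, hasGradientAt_iff_hasFDerivAt, map_add]
    exact ih.hasFDerivAt.add hlast.hasFDerivAt

lemma differentiable_J (hr : M.BoundedReward R₀) (hpol : pol.Regular G L) :
    Differentiable ℝ (M.J pol H) :=
  fun θ => (hasGradientAt_J hr hpol θ).differentiableAt

lemma gradient_J (hr : M.BoundedReward R₀) (hpol : pol.Regular G L) :
    gradient (M.J pol H) = fun θ => ∫ τ, M.gradEst pol τ θ ∂(M.trajLaw pol H θ) :=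
  gradient_eq (hasGradientAt_J hr hpol)

theorem hasFDerivAt_gradient_J (hr : M.BoundedReward R₀) (hpol : pol.Regular G L)
    (θ : EuclideanSpace ℝ (Fin d)) :
    HasFDerivAt (gradient (M.J pol H)) (∫ τ, M.hessEst pol τ θ ∂(M.trajLaw pol H θ)) θ := by
  rw [gradient_J hr hpol]
  simp only [M.hessEst_eq hpol]
  exact M.hasFDerivAt_integral_trajLaw (F := M.gradEst pol)
    (F' := fun τ => fderiv ℝ (M.gradEst pol τ)) hpol
    (fun τ θ => (M.differentiable_gradEst hpol τ θ).hasFDerivAt)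
    (fun θ => (M.measurable_gradEst_left hpol θ).stronglyMeasurable)
    (fun _ => (M.stronglyMeasurable_fderiv_gradEst hpol).of_uncurry_right)
    (norm_gradEst_le hr hpol) (norm_fderiv_gradEst_le hr hpol) θ

lemma abs_J_le (hr : M.BoundedReward R₀) (θ : EuclideanSpace ℝ (Fin d)) :
    |M.J pol H θ| ≤ |R₀| / (1 - M.γ) := by
  simpa [J] using norm_integral_le_of_norm_le_const (μ := M.trajLaw pol H θ) (f := M.ret)
    (Filter.Eventually.of_forall fun τ => abs_ret_le hr τ)

lemma norm_gradient_J_le (hr : M.BoundedReward R₀) (hpol : pol.Regular G L)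
    (θ : EuclideanSpace ℝ (Fin d)) : ‖gradient (M.J pol H) θ‖ ≤ M.sigmaG R₀ G := by
  rw [gradient_J hr hpol]
  simpa using norm_integral_le_of_norm_le_const (μ := M.trajLaw pol H θ)
    (Filter.Eventually.of_forall fun τ => norm_gradEst_le hr hpol τ θ)

lemma norm_integral_hessEst_le (hr : M.BoundedReward R₀) (hpol : pol.Regular G L)
    (θ : EuclideanSpace ℝ (Fin d)) :
    ‖∫ τ, M.hessEst pol τ θ ∂(M.trajLaw pol H θ)‖ ≤ 2 * M.sigmaB H R₀ G L := by
  simpa using norm_integral_le_of_norm_le_const (μ := M.trajLaw pol H θ)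
    (Filter.Eventually.of_forall fun τ => norm_hessEst_le hr hpol τ θ)

lemma lipschitzWith_gradient_J (hr : M.BoundedReward R₀) (hpol : pol.Regular G L) :
    LipschitzWith (2 * M.sigmaB H R₀ G L).toNNReal (gradient (M.J pol H)) := by
  refine lipschitzWith_of_nnnorm_fderiv_le
    (fun θ => (hasFDerivAt_gradient_J hr hpol θ).differentiableAt) fun θ => ?_
  rw [(hasFDerivAt_gradient_J hr hpol θ).fderiv]
  exact NNReal.coe_le_coe.1 ((norm_integral_hessEst_le hr hpol θ).trans (Real.le_coe_toNNReal _))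

end MDP

/-! ### One sampling step -/

instance isProbabilityMeasure_volume_restrict_Icc_zero_one :
    IsProbabilityMeasure (volume.restrict (Set.Icc (0 : ℝ) 1)) := ⟨by simp⟩

namespace MDP

variable {S A : Type*} [MeasurableSpace S] [MeasurableSpace A] (M : MDP S A)
  {d H : ℕ} {ν : Measure A} {pol : ParamPolicy S A d ν} {R₀ G L : ℝ}

/-- The stochastic part of the SHARP update with momentum weight `α`, as a function of
`p = (θ_t, θ_{t-1})` and of the samples `x = (b_t, τ_t, τ_t^b)`. -/
noncomputable def sharpIncrement (pol : ParamPolicy S A d ν) (α : ℝ)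
    (p : EuclideanSpace ℝ (Fin d) × EuclideanSpace ℝ (Fin d)) (x : ℝ × Traj S A H × Traj S A H) :
    EuclideanSpace ℝ (Fin d) :=
  (1 - α) • M.hessEst pol x.2.2 (x.1 • p.1 + (1 - x.1) • p.2) (p.1 - p.2) +
    α • M.gradEst pol x.2.1 p.1

lemma stronglyMeasurable_sharpIncrement (hpol : pol.Regular G L) (α : ℝ) :
    StronglyMeasurable fun z : (EuclideanSpace ℝ (Fin d) × EuclideanSpace ℝ (Fin d)) ×
      (ℝ × Traj S A H × Traj S A H) => M.sharpIncrement pol α z.1 z.2 := by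
  have hpoint : Measurable fun z : (EuclideanSpace ℝ (Fin d) × EuclideanSpace ℝ (Fin d)) ×
      (ℝ × Traj S A H × Traj S A H) =>
      (z.2.2.2, z.2.1 • z.1.1 + (1 - z.2.1) • z.1.2) := by fun_prop
  have hdiff : Measurable fun z : (EuclideanSpace ℝ (Fin d) × EuclideanSpace ℝ (Fin d)) ×
      (ℝ × Traj S A H × Traj S A H) => z.1.1 - z.1.2 := by fun_prop
  have hgrad : Measurable fun z : (EuclideanSpace ℝ (Fin d) × EuclideanSpace ℝ (Fin d)) ×
      (ℝ × Traj S A H × Traj S A H) => (z.2.2.1, z.1.1) := by fun_prop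
  have hhess := ((M.stronglyMeasurable_hessEst (H := H) hpol).comp_measurable hpoint).prodMk
    hdiff.stronglyMeasurable
  exact ((isBoundedBilinearMap_apply.continuous.comp_stronglyMeasurable hhess).const_smul
    (1 - α)).add (((M.measurable_gradEst (H := H) hpol).comp hgrad).stronglyMeasurable.const_smul α)

variable {M} in
lemma norm_sharpIncrement_le (hr : M.BoundedReward R₀) (hpol : pol.Regular G L) {α δ : ℝ}
    (hα : 0 ≤ α) (hα' : α ≤ 1) {p : EuclideanSpace ℝ (Fin d) × EuclideanSpace ℝ (Fin d)}
    (hp : ‖p.1 - p.2‖ ≤ δ) (x : ℝ × Traj S A H × Traj S A H) :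
    ‖M.sharpIncrement pol α p x‖ ≤
      (1 - α) * (2 * M.sigmaB H R₀ G L * δ) + α * M.sigmaG R₀ G := by
  refine norm_add_le_of_le ?_ ?_
  · rw [norm_smul, Real.norm_of_nonneg (sub_nonneg.2 hα')]
    exact mul_le_mul_of_nonneg_left
      (ContinuousLinearMap.le_of_opNorm_le_of_le _ (norm_hessEst_le hr hpol _ _) hp)
      (sub_nonneg.2 hα')
  · rw [norm_smul, Real.norm_of_nonneg hα]
    exact mul_le_mul_of_nonneg_left (norm_gradEst_le hr hpol _ _) hα

lemma measurable_segmentPoint : Measurable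
    fun p : (EuclideanSpace ℝ (Fin d) × EuclideanSpace ℝ (Fin d)) × ℝ =>
      p.2 • p.1.1 + (1 - p.2) • p.1.2 := by
  fun_prop

variable [SFinite ν]

/-- The joint law of `(b_t, τ_t, τ_t^b)` given `(θ_t, θ_{t-1})`. -/
noncomputable def sampleKernel (pol : ParamPolicy S A d ν) (H : ℕ) :
    Kernel (EuclideanSpace ℝ (Fin d) × EuclideanSpace ℝ (Fin d))
      (ℝ × Traj S A H × Traj S A H) :=
  Kernel.const _ (volume.restrict (Set.Icc (0 : ℝ) 1)) ⊗ₖ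
    ((M.trajKernel pol H).comap (fun p => p.1.1) measurable_fst.fst ×ₖ
      (M.trajKernel pol H).comap _ measurable_segmentPoint)

instance isMarkovKernel_sampleKernel : IsMarkovKernel (M.sampleKernel pol H) := by
  unfold sampleKernel
  infer_instance

lemma lintegral_sampleKernel (p : EuclideanSpace ℝ (Fin d) × EuclideanSpace ℝ (Fin d))
    {f : ℝ × Traj S A H × Traj S A H → ℝ≥0∞} (hf : Measurable f) :
    ∫⁻ x, f x ∂(M.sampleKernel pol H p) = ∫⁻ u in Set.Icc (0 : ℝ) 1, ∫⁻ y, ∫⁻ y', f (u, y, y')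
      ∂(M.trajLaw pol H (u • p.1 + (1 - u) • p.2)) ∂(M.trajLaw pol H p.1) := by
  rw [sampleKernel, Kernel.lintegral_compProd _ _ _ hf, Kernel.const_apply]
  refine lintegral_congr fun u => ?_
  rw [Kernel.prod_apply]
  exact lintegral_prod _ (hf.comp measurable_prodMk_left).aemeasurable

lemma integral_sampleKernel_traj {V : Type*} [NormedAddCommGroup V] [NormedSpace ℝ V]
    [CompleteSpace V] (p : EuclideanSpace ℝ (Fin d) × EuclideanSpace ℝ (Fin d))
    {f : Traj S A H → V}
    (hf : Integrable (fun x : ℝ × Traj S A H × Traj S A H => f x.2.1) (M.sampleKernel pol H p)) :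
    ∫ x, f x.2.1 ∂(M.sampleKernel pol H p) = ∫ y, f y ∂(M.trajLaw pol H p.1) := by
  unfold sampleKernel at hf ⊢
  rw [ProbabilityTheory.integral_compProd hf]
  simp only [Kernel.prod_apply, Kernel.const_apply, Kernel.comap_apply, trajKernel_apply,
    integral_fun_fst, probReal_univ, one_smul, integral_const]

lemma integral_sampleKernel_segment {V : Type*} [NormedAddCommGroup V] [NormedSpace ℝ V]
    [CompleteSpace V] (p : EuclideanSpace ℝ (Fin d) × EuclideanSpace ℝ (Fin d))
    {f : ℝ → Traj S A H → V}
    (hf : Integrable (fun x : ℝ × Traj S A H × Traj S A H => f x.1 x.2.2)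
      (M.sampleKernel pol H p)) :
    ∫ x, f x.1 x.2.2 ∂(M.sampleKernel pol H p) =
      ∫ u in Set.Icc (0 : ℝ) 1, ∫ y, f u y ∂(M.trajLaw pol H (u • p.1 + (1 - u) • p.2)) := by
  unfold sampleKernel at hf ⊢
  rw [ProbabilityTheory.integral_compProd hf]
  simp only [Kernel.prod_apply, Kernel.const_apply, Kernel.comap_apply, trajKernel_apply,
    integral_fun_snd, probReal_univ, one_smul]

variable {M}

lemma integrable_hessEst (hr : M.BoundedReward R₀) (hpol : pol.Regular G L)
    (θ : EuclideanSpace ℝ (Fin d)) :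
    Integrable (fun τ => M.hessEst pol τ θ) (M.trajLaw pol H θ) :=
  Integrable.of_bound (M.stronglyMeasurable_hessEst hpol).of_uncurry_right.aestronglyMeasurable _
    (Filter.Eventually.of_forall fun τ => norm_hessEst_le hr hpol τ θ)

/-- Along a uniform point of a segment the Hessian averages to the increment of the gradient, so
the Hessian term of the update is unbiased for `∇J(θ_t) - ∇J(θ_{t-1})`. -/
theorem integral_hessEst_segment (hr : M.BoundedReward R₀) (hpol : pol.Regular G L)
    (θ θ' : EuclideanSpace ℝ (Fin d)) :
    ∫ u in Set.Icc (0 : ℝ) 1, ∫ τ, M.hessEst pol τ (u • θ + (1 - u) • θ') (θ - θ')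
      ∂(M.trajLaw pol H (u • θ + (1 - u) • θ')) =
      gradient (M.J pol H) θ - gradient (M.J pol H) θ' := by
  simp only [← ContinuousLinearMap.integral_apply (integrable_hessEst hr hpol _)]
  exact setIntegral_Icc_fderiv_segment (hasFDerivAt_gradient_J hr hpol)
    (norm_integral_hessEst_le hr hpol) θ θ'

theorem integral_sharpIncrement (hr : M.BoundedReward R₀) (hpol : pol.Regular G L) {α : ℝ}
    (p : EuclideanSpace ℝ (Fin d) × EuclideanSpace ℝ (Fin d)) :
    ∫ x, M.sharpIncrement pol α p x ∂(M.sampleKernel pol H p) =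
      (1 - α) • (gradient (M.J pol H) p.1 - gradient (M.J pol H) p.2) +
        α • gradient (M.J pol H) p.1 := by
  have hpoint : Measurable fun x : ℝ × Traj S A H × Traj S A H =>
      (x.2.2, x.1 • p.1 + (1 - x.1) • p.2) := by fun_prop
  have hhess : Integrable (fun x : ℝ × Traj S A H × Traj S A H =>
      M.hessEst pol x.2.2 (x.1 • p.1 + (1 - x.1) • p.2) (p.1 - p.2)) (M.sampleKernel pol H p) :=
    (Integrable.of_bound
      ((M.stronglyMeasurable_hessEst hpol).comp_measurable hpoint).aestronglyMeasurable _
      (.of_forall fun x => norm_hessEst_le hr hpol _ _)).apply_continuousLinearMap _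
  have hgrad : Integrable (fun x : ℝ × Traj S A H × Traj S A H => M.gradEst pol x.2.1 p.1)
      (M.sampleKernel pol H p) :=
    Integrable.of_bound ((M.measurable_gradEst_left hpol p.1).comp
      measurable_snd.fst).aestronglyMeasurable _
      (Filter.Eventually.of_forall fun x => norm_gradEst_le hr hpol _ _)
  refine (integral_add (hhess.smul (1 - α)) (hgrad.smul α)).trans ?_
  simp only [Pi.smul_apply]
  rw [integral_smul, integral_smul,
    integral_sampleKernel_segment M p
      (f := fun u y => M.hessEst pol y (u • p.1 + (1 - u) • p.2) (p.1 - p.2)) hhess,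
    integral_sampleKernel_traj M p (f := fun y => M.gradEst pol y p.1) hgrad,
    integral_hessEst_segment hr hpol, gradient_J hr hpol]

end MDP

/-! ### SHARP step sizes -/

section StepSizes

variable {α₀ η₀ σg σB : ℝ}

lemma sharpEta_of_pos {t : ℕ} (ht : 1 ≤ t) : sharpEta η₀ t = η₀ / (t : ℝ) ^ ((2 : ℝ) / 3) :=
  if_neg (by omega)

lemma sharpEta_nonneg (hη₀ : 0 ≤ η₀) (t : ℕ) : 0 ≤ sharpEta η₀ t := by
  unfold sharpEta
  positivity

lemma sharpEta_le_two_mul_div (hη₀ : 0 ≤ η₀) (t : ℕ) :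
    sharpEta η₀ t ≤ 2 * η₀ / (t + 1 : ℝ) ^ ((2 : ℝ) / 3) := by
  obtain rfl | ht := Nat.eq_zero_or_pos t
  · simpa [sharpEta] using le_mul_of_one_le_left hη₀ one_le_two
  · have ht' : (1 : ℝ) ≤ t := by exact_mod_cast ht
    have hdouble : (t + 1 : ℝ) ^ ((2 : ℝ) / 3) ≤ 2 * (t : ℝ) ^ ((2 : ℝ) / 3) :=
      calc (t + 1 : ℝ) ^ ((2 : ℝ) / 3) ≤ (2 * t : ℝ) ^ ((2 : ℝ) / 3) := by gcongr; linarith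
        _ = 2 ^ ((2 : ℝ) / 3) * (t : ℝ) ^ ((2 : ℝ) / 3) := Real.mul_rpow two_pos.le (by positivity)
        _ ≤ 2 * (t : ℝ) ^ ((2 : ℝ) / 3) := by
          gcongr
          exact Real.rpow_le_self_of_one_le one_le_two (by norm_num)
    rw [sharpEta_of_pos ht, div_le_div_iff₀ (by positivity) (by positivity)]
    nlinarith [mul_le_mul_of_nonneg_left hdouble hη₀]

lemma sharpAlpha_nonneg (hα₀ : 0 ≤ α₀) (t : ℕ) : 0 ≤ sharpAlpha α₀ t := by
  unfold sharpAlpha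
  positivity

lemma sharpAlpha_succ_le_one (hα₀ : α₀ ≤ 1) (t : ℕ) : sharpAlpha α₀ (t + 1) ≤ 1 :=
  div_le_one_of_le₀ (hα₀.trans (Real.one_le_rpow (by simp) (by norm_num))) (by positivity)

lemma sharpC_mul_sub (hα₀ : 2 / 3 < α₀) :
    sharpC α₀ η₀ σg σB * (α₀ - 2 / 3) =
      48 * σB ^ 2 * η₀ ^ 2 + (6 * α₀ ^ 2 + 1) * σg ^ 2 := by
  have hden : 3 * α₀ - 2 ≠ 0 := by linarith
  have hα₀' : α₀ ≠ 0 := by linarith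
  unfold sharpC
  field_simp

lemma le_sharpC (hα₀ : 2 / 3 < α₀) (hα₀' : α₀ ≤ 1) :
    144 * σB ^ 2 * η₀ ^ 2 + 3 * (6 * α₀ ^ 2 + 1) * σg ^ 2 ≤ sharpC α₀ η₀ σg σB := by
  have hmul := sharpC_mul_sub (η₀ := η₀) (σg := σg) (σB := σB) hα₀
  have hC : 0 ≤ sharpC α₀ η₀ σg σB :=
    nonneg_of_mul_nonneg_left (hmul ▸ by positivity) (sub_pos.2 hα₀)
  nlinarith [mul_nonneg hC (sub_nonneg.2 hα₀')]

lemma le_sqrt_sharpC (hα₀ : 2 / 3 < α₀) (hα₀' : α₀ ≤ 1) : σg ≤ √(sharpC α₀ η₀ σg σB) := by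
  refine Real.le_sqrt_of_sq_le (le_trans ?_ (le_sharpC hα₀ hα₀'))
  nlinarith [sq_nonneg (σB * η₀), sq_nonneg (α₀ * σg), sq_nonneg σg]

lemma sq_increment_bound_le (hα₀ : 0 ≤ α₀) (hα₀' : α₀ ≤ 1) (hη₀ : 0 ≤ η₀) (t : ℕ) :
    ((1 - sharpAlpha α₀ (t + 1)) * (2 * σB * sharpEta η₀ t) + sharpAlpha α₀ (t + 1) * σg) ^ 2 ≤
      (32 * σB ^ 2 * η₀ ^ 2 + 2 * α₀ ^ 2 * σg ^ 2) / ((t + 1 : ℝ) ^ ((2 : ℝ) / 3)) ^ 2 := by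
  have hα := sharpAlpha_nonneg hα₀ (t + 1)
  have hη := sharpEta_nonneg hη₀ t
  have hmix : ((1 - sharpAlpha α₀ (t + 1)) * sharpEta η₀ t) ^ 2 ≤
      (2 * η₀ / (t + 1 : ℝ) ^ ((2 : ℝ) / 3)) ^ 2 := by
    refine pow_le_pow_left₀ (mul_nonneg (sub_nonneg.2 (sharpAlpha_succ_le_one hα₀' t)) hη) ?_ 2
    exact (mul_le_of_le_one_left hη (by linarith)).trans (sharpEta_le_two_mul_div hη₀ t)
  calc ((1 - sharpAlpha α₀ (t + 1)) * (2 * σB * sharpEta η₀ t) + sharpAlpha α₀ (t + 1) * σg) ^ 2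
      ≤ 2 * (((1 - sharpAlpha α₀ (t + 1)) * (2 * σB * sharpEta η₀ t)) ^ 2 +
          (sharpAlpha α₀ (t + 1) * σg) ^ 2) := add_sq_le
    _ = 8 * σB ^ 2 * ((1 - sharpAlpha α₀ (t + 1)) * sharpEta η₀ t) ^ 2 +
          2 * (sharpAlpha α₀ (t + 1) * σg) ^ 2 := by ring
    _ ≤ 8 * σB ^ 2 * (2 * η₀ / (t + 1 : ℝ) ^ ((2 : ℝ) / 3)) ^ 2 +
          2 * (sharpAlpha α₀ (t + 1) * σg) ^ 2 := by gcongr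
    _ = _ := by
      simp only [sharpAlpha, Nat.cast_add, Nat.cast_one]
      field_simp
      ring

/-- The choice of `C` absorbs the initial error and closes the recursion of the mean squared
momentum error. -/
theorem le_sharpC_div_of_recursion {a : ℕ → ℝ} {T : ℕ} (hα₀ : 2 / 3 < α₀) (hα₀' : α₀ ≤ 1)
    (hη₀ : 0 ≤ η₀) (ha : ∀ t, 0 ≤ a t) (ha₀ : a 0 ≤ 4 * σg ^ 2)
    (hstep : ∀ t, t + 1 < T → a (t + 1) ≤ (1 - sharpAlpha α₀ (t + 1)) ^ 2 * a t +
      ((1 - sharpAlpha α₀ (t + 1)) * (2 * σB * sharpEta η₀ t) + sharpAlpha α₀ (t + 1) * σg) ^ 2)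
    {t : ℕ} (ht : 1 ≤ t) (htT : t < T) :
    a t ≤ sharpC α₀ η₀ σg σB / (t : ℝ) ^ ((2 : ℝ) / 3) := by
  have hα₀_nonneg : 0 ≤ α₀ := by linarith
  have hmul := sharpC_mul_sub (η₀ := η₀) (σg := σg) (σB := σB) hα₀
  have hC := le_sharpC (η₀ := η₀) (σg := σg) (σB := σB) hα₀ hα₀'
  have hstep' : ∀ t, t + 1 < T → a (t + 1) ≤ (1 - sharpAlpha α₀ (t + 1)) ^ 2 * a t +
      (32 * σB ^ 2 * η₀ ^ 2 + 2 * α₀ ^ 2 * σg ^ 2) / ((t + 1 : ℝ) ^ ((2 : ℝ) / 3)) ^ 2 :=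
    fun t ht => (hstep t ht).trans
      (add_le_add_right (sq_increment_bound_le hα₀_nonneg hα₀' hη₀ t) _)
  have hD : 32 * σB ^ 2 * η₀ ^ 2 + 2 * α₀ ^ 2 * σg ^ 2 ≤
      sharpC α₀ η₀ σg σB * (α₀ - 2 / 3) := by
    rw [hmul]
    nlinarith [sq_nonneg (σB * η₀), sq_nonneg (α₀ * σg), sq_nonneg σg]
  have ha₁ (hT : 1 < T) : a 1 ≤ sharpC α₀ η₀ σg σB := by
    have hone := hstep' 0 hT
    simp only [sharpAlpha, zero_add, Nat.cast_one, Nat.cast_zero, Real.one_rpow, div_one,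
      one_pow] at hone
    have hcoef : (1 - α₀) ^ 2 ≤ 1 := pow_le_one₀ (by linarith) (by linarith)
    nlinarith [mul_le_mul hcoef ha₀ (ha 0) zero_le_one, sq_nonneg (σB * η₀), sq_nonneg (α₀ * σg),
      mul_le_mul_of_nonneg_right (pow_le_pow_left₀ (by norm_num) hα₀.le 2) (sq_nonneg σg)]
  refine le_div_rpow_of_recursion (T := T) (by norm_num) hα₀.le hα₀' (le_trans (by positivity) hC)
    hD (ha₁ (ht.trans_lt htT)) (fun t _ ht => ?_) ht htT
  have hα := sharpAlpha_nonneg hα₀_nonneg (t + 1)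
  have hα' := sharpAlpha_succ_le_one hα₀' t
  refine (hstep' t ht).trans (add_le_add_left (mul_le_mul_of_nonneg_right ?_ (ha t)) _)
  rw [show α₀ / (t + 1 : ℝ) ^ ((2 : ℝ) / 3) = sharpAlpha α₀ (t + 1) by simp [sharpAlpha]]
  nlinarith

end StepSizes

/-! ### Runs of SHARP -/

/-- The error `e_t = v_t - ∇J(θ_t)` of the momentum vector `v_t` as an estimate of the policy
gradient. -/
noncomputable def MDP.momentumError {S A Ω : Type*} [MeasurableSpace S] [MeasurableSpace A]
    {d : ℕ} {ν : Measure A} (M : MDP S A) (pol : ParamPolicy S A d ν) (H : ℕ)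
    (θ v : ℕ → Ω → EuclideanSpace ℝ (Fin d)) (t : ℕ) (ω : Ω) : EuclideanSpace ℝ (Fin d) :=
  v t ω - gradient (M.J pol H) (θ t ω)

namespace IsSharpRun

open MDP

variable {S A Ω : Type*} [MeasurableSpace S] [MeasurableSpace A] [mΩ : MeasurableSpace Ω]
  {d : ℕ} {ν : Measure A} {M : MDP S A} {pol : ParamPolicy S A d ν} {H T : ℕ}
  {θ₀ : EuclideanSpace ℝ (Fin d)} {α₀ η₀ : ℝ} {μ : Measure Ω}
  {ℱ : Filtration ℕ mΩ} {θ v : ℕ → Ω → EuclideanSpace ℝ (Fin d)} {b : ℕ → Ω → ℝ}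
  {τ τb : ℕ → Ω → Traj S A H} {R₀ G L : ℝ}

lemma v_succ (hrun : IsSharpRun M pol H T θ₀ α₀ η₀ μ ℱ θ v b τ τb) {t : ℕ} (ht : t + 1 < T)
    (ω : Ω) : v (t + 1) ω = (1 - sharpAlpha α₀ (t + 1)) • v t ω +
      M.sharpIncrement pol (sharpAlpha α₀ (t + 1)) (θ (t + 1) ω, θ t ω)
        (b (t + 1) ω, τ (t + 1) ω, τb (t + 1) ω) := by
  rw [hrun.v_step (t + 1) t.succ_pos ht ω, sharpIncrement, smul_add, add_assoc,
    Nat.add_sub_cancel]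

lemma norm_theta_succ_sub_le (hrun : IsSharpRun M pol H T θ₀ α₀ η₀ μ ℱ θ v b τ τb) (hη₀ : 0 ≤ η₀)
    {t : ℕ} (ht : t < T) (ω : Ω) : ‖θ (t + 1) ω - θ t ω‖ ≤ sharpEta η₀ t := by
  rw [hrun.theta_step t ht ω, add_sub_cancel_left, norm_smul,
    Real.norm_of_nonneg (sharpEta_nonneg hη₀ t)]
  exact mul_le_of_le_one_right (sharpEta_nonneg hη₀ t) (norm_norm_inv_smul_le_one _)

lemma measurable_theta_succ_of_measurable (hrun : IsSharpRun M pol H T θ₀ α₀ η₀ μ ℱ θ v b τ τb)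
    {t : ℕ} (ht : t < T) (hθ : Measurable[ℱ t] (θ t)) (hv : Measurable[ℱ t] (v t)) :
    Measurable[ℱ t] (θ (t + 1)) := by
  have hstep : Measurable fun x : EuclideanSpace ℝ (Fin d) × EuclideanSpace ℝ (Fin d) =>
      x.1 + sharpEta η₀ t • (‖x.2‖⁻¹ • x.2) := by fun_prop
  rw [funext (hrun.theta_step t ht)]
  exact hstep.comp (hθ.prodMk hv)

lemma measurable_sample_succ (hrun : IsSharpRun M pol H T θ₀ α₀ η₀ μ ℱ θ v b τ τb) {t : ℕ}
    (ht : t + 1 < T) :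
    Measurable[ℱ (t + 1)] fun ω => (b (t + 1) ω, τ (t + 1) ω, τb (t + 1) ω) :=
  (hrun.measurable_unif _ t.succ_pos ht).prodMk
    ((hrun.measurable_traj _ ht).prodMk (hrun.measurable_trajb _ t.succ_pos ht))

lemma measurable_theta_and_v (hrun : IsSharpRun M pol H T θ₀ α₀ η₀ μ ℱ θ v b τ τb)
    (hpol : pol.Regular G L) {t : ℕ} (ht : t < T) :
    Measurable[ℱ t] (θ t) ∧ Measurable[ℱ t] (v t) := by
  induction t with
  | zero =>
    have hv : v 0 = fun ω => M.gradEst pol (τ 0 ω) θ₀ := by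
      funext ω
      rw [hrun.v_zero ω, hrun.theta_zero ω]
    rw [funext hrun.theta_zero, hv]
    exact ⟨measurable_const,
      (M.measurable_gradEst_left hpol θ₀).comp (hrun.measurable_traj 0 ht)⟩
  | succ t ih =>
    obtain ⟨hθ, hv⟩ := ih (by omega)
    have hle : ℱ t ≤ ℱ (t + 1) := ℱ.mono t.le_succ
    have hθ' : Measurable[ℱ (t + 1)] (θ (t + 1)) :=
      (hrun.measurable_theta_succ_of_measurable (by omega) hθ hv).mono hle le_rfl
    refine ⟨hθ', ?_⟩
    have hincr := (M.stronglyMeasurable_sharpIncrement (H := H) hpol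
      (sharpAlpha α₀ (t + 1))).measurable.comp
      ((hθ'.prodMk (hθ.mono hle le_rfl)).prodMk (hrun.measurable_sample_succ ht))
    have hcomb : Measurable fun x : EuclideanSpace ℝ (Fin d) × EuclideanSpace ℝ (Fin d) =>
        (1 - sharpAlpha α₀ (t + 1)) • x.1 + x.2 := by fun_prop
    rw [funext (hrun.v_succ ht)]
    exact hcomb.comp ((hv.mono hle le_rfl).prodMk hincr)

lemma measurable_theta_succ (hrun : IsSharpRun M pol H T θ₀ α₀ η₀ μ ℱ θ v b τ τb)
    (hpol : pol.Regular G L) {t : ℕ} (ht : t < T) : Measurable[ℱ t] (θ (t + 1)) :=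
  hrun.measurable_theta_succ_of_measurable ht (hrun.measurable_theta_and_v hpol ht).1
    (hrun.measurable_theta_and_v hpol ht).2

lemma memLp_v [IsFiniteMeasure μ] (hrun : IsSharpRun M pol H T θ₀ α₀ η₀ μ ℱ θ v b τ τb)
    (hr : M.BoundedReward R₀) (hpol : pol.Regular G L) (hα₀ : 0 ≤ α₀) (hα₀' : α₀ ≤ 1)
    (hη₀ : 0 ≤ η₀) {t : ℕ} (ht : t < T) : MemLp (v t) 2 μ := by
  have hmeas : ∀ t < T, AEStronglyMeasurable (v t) μ := fun t ht =>
    ((hrun.measurable_theta_and_v hpol ht).2.mono (ℱ.le _) le_rfl).aestronglyMeasurable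
  induction t with
  | zero =>
    refine .of_bound (hmeas 0 ht) (M.sigmaG R₀ G) (.of_forall fun ω => ?_)
    rw [hrun.v_zero]
    exact norm_gradEst_le hr hpol _ _
  | succ t ih =>
    have hscaled : MemLp (fun ω => (1 - sharpAlpha α₀ (t + 1)) • v t ω) 2 μ :=
      MemLp.const_smul (ih (by omega)) (1 - sharpAlpha α₀ (t + 1))
    have hincr (ω : Ω) : ‖v (t + 1) ω - (1 - sharpAlpha α₀ (t + 1)) • v t ω‖ ≤
        (1 - sharpAlpha α₀ (t + 1)) * (2 * M.sigmaB H R₀ G L * sharpEta η₀ t) +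
          sharpAlpha α₀ (t + 1) * M.sigmaG R₀ G := by
      rw [hrun.v_succ ht, add_sub_cancel_left]
      exact norm_sharpIncrement_le (p := (θ (t + 1) ω, θ t ω)) hr hpol (sharpAlpha_nonneg hα₀ _)
        (sharpAlpha_succ_le_one hα₀' t) (hrun.norm_theta_succ_sub_le hη₀ (by omega) ω) _
    have hdiff := MemLp.of_bound (p := 2) ((hmeas _ ht).sub hscaled.1) _ (.of_forall hincr)
    simpa only [sub_add_cancel] using hdiff.add hscaled

variable [SFinite ν]

lemma measurable_momentumError (hrun : IsSharpRun M pol H T θ₀ α₀ η₀ μ ℱ θ v b τ τb)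
    (hr : M.BoundedReward R₀) (hpol : pol.Regular G L) {t : ℕ} (ht : t < T) :
    Measurable[ℱ t] (M.momentumError pol H θ v t) :=
  (hrun.measurable_theta_and_v hpol ht).2.sub
    ((lipschitzWith_gradient_J hr hpol).continuous.measurable.comp
      (hrun.measurable_theta_and_v hpol ht).1)

lemma memLp_momentumError [IsFiniteMeasure μ]
    (hrun : IsSharpRun M pol H T θ₀ α₀ η₀ μ ℱ θ v b τ τb) (hr : M.BoundedReward R₀)
    (hpol : pol.Regular G L) (hα₀ : 0 ≤ α₀) (hα₀' : α₀ ≤ 1) (hη₀ : 0 ≤ η₀) {t : ℕ} (ht : t < T) :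
    MemLp (M.momentumError pol H θ v t) 2 μ := by
  refine (hrun.memLp_v hr hpol hα₀ hα₀' hη₀ ht).sub
    (.of_bound ?_ _ (.of_forall fun ω => norm_gradient_J_le hr hpol _))
  exact ((lipschitzWith_gradient_J hr hpol).continuous.measurable.comp
    ((hrun.measurable_theta_and_v hpol ht).1.mono (ℱ.le _) le_rfl)).aestronglyMeasurable

theorem momentumError_succ (hrun : IsSharpRun M pol H T θ₀ α₀ η₀ μ ℱ θ v b τ τb)
    (hr : M.BoundedReward R₀) (hpol : pol.Regular G L) {t : ℕ} (ht : t + 1 < T) (ω : Ω) :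
    M.momentumError pol H θ v (t + 1) ω =
      (1 - sharpAlpha α₀ (t + 1)) • M.momentumError pol H θ v t ω +
        (M.sharpIncrement pol (sharpAlpha α₀ (t + 1)) (θ (t + 1) ω, θ t ω)
            (b (t + 1) ω, τ (t + 1) ω, τb (t + 1) ω) -
          ∫ x, M.sharpIncrement pol (sharpAlpha α₀ (t + 1)) (θ (t + 1) ω, θ t ω) x
            ∂(M.sampleKernel pol H (θ (t + 1) ω, θ t ω))) := by
  rw [integral_sharpIncrement hr hpol, momentumError, momentumError, hrun.v_succ ht]
  module

lemma norm_momentumError_zero_le (hrun : IsSharpRun M pol H T θ₀ α₀ η₀ μ ℱ θ v b τ τb)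
    (hr : M.BoundedReward R₀) (hpol : pol.Regular G L) (ω : Ω) :
    ‖M.momentumError pol H θ v 0 ω‖ ≤ 2 * M.sigmaG R₀ G := by
  rw [momentumError, hrun.v_zero, two_mul]
  exact norm_sub_le_of_le (norm_gradEst_le hr hpol _ _) (norm_gradient_J_le hr hpol _)

lemma sum_Ico_norm_gradient_J_le (hrun : IsSharpRun M pol H T θ₀ α₀ η₀ μ ℱ θ v b τ τb)
    (hr : M.BoundedReward R₀) (hpol : pol.Regular G L) (hη₀ : 0 < η₀) (hT : 1 ≤ T) (ω : Ω) :
    ∑ t ∈ Finset.Ico 1 T, ‖gradient (M.J pol H) (θ t ω)‖ ≤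
      2 * (|R₀| / (1 - M.γ)) / η₀ * (T : ℝ) ^ ((2 : ℝ) / 3) +
      2 * ∑ t ∈ Finset.Ico 1 T, ‖M.momentumError pol H θ v t ω‖ +
      6 * M.sigmaB H R₀ G L * η₀ * (T : ℝ) ^ ((1 : ℝ) / 3) := by
  have hσ : 0 ≤ M.sigmaB H R₀ G L := Real.sqrt_nonneg _
  refine (sum_Ico_norm_gradient_le_of_normalized_steps (x := fun t => θ t ω) (v := fun t => v t ω)
    (p := 2 / 3) (differentiable_J hr hpol) (lipschitzWith_gradient_J hr hpol) (abs_J_le hr) hη₀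
    (by norm_num) (by norm_num) hT fun t ht htT => ?_).trans (le_of_eq ?_)
  · rw [hrun.theta_step t htT, sharpEta_of_pos ht]
  · rw [Real.coe_toNNReal _ (by positivity), show (1 : ℝ) - 2 / 3 = 1 / 3 by norm_num]
    simp only [momentumError]
    ring

variable [IsProbabilityMeasure μ]

theorem map_prodMk_sample_succ (hrun : IsSharpRun M pol H T θ₀ α₀ η₀ μ ℱ θ v b τ τb)
    (hpol : pol.Regular G L) {t : ℕ} (ht : t + 1 < T) {W : Type*} [MeasurableSpace W] {U : Ω → W}
    (hU : Measurable[ℱ t] U) :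
    μ.map (fun ω => ((U ω, θ (t + 1) ω, θ t ω), (b (t + 1) ω, τ (t + 1) ω, τb (t + 1) ω))) =
      μ.map (fun ω => (U ω, θ (t + 1) ω, θ t ω)) ⊗ₘ
        (M.sampleKernel pol H).comap Prod.snd measurable_snd := by
  have hV : Measurable[ℱ t] fun ω => (U ω, θ (t + 1) ω, θ t ω) :=
    hU.prodMk ((hrun.measurable_theta_succ hpol (by omega)).prodMk
      (hrun.measurable_theta_and_v hpol (by omega)).1)
  have hV' : Measurable fun ω => (U ω, θ (t + 1) ω, θ t ω) := hV.mono (ℱ.le _) le_rfl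
  have hX : Measurable fun ω => (b (t + 1) ω, τ (t + 1) ω, τb (t + 1) ω) :=
    (hrun.measurable_sample_succ ht).mono (ℱ.le _) le_rfl
  have := Measure.isProbabilityMeasure_map (μ := μ) hV'.aemeasurable
  have := Measure.isProbabilityMeasure_map (μ := μ) (hV'.prodMk hX).aemeasurable
  refine Measure.ext_prod fun {s u} hs hu => ?_
  rw [Measure.compProd_apply_prod hs hu, Measure.map_apply (hV'.prodMk hX) (hs.prod hu),
    setLIntegral_map hs (Kernel.measurable_coe _ hu) hV', Set.mk_preimage_prod, Set.inter_comm,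
    ← Measure.restrict_apply (hX hu), ← lintegral_indicator_one (hX hu)]
  refine (hrun.sampling (t + 1) t.succ_pos ht _ (hV hs) (u.indicator 1)
    (measurable_one.indicator hu)).trans (lintegral_congr fun ω => ?_)
  rw [Kernel.comap_apply, ← lintegral_indicator_one hu,
    lintegral_sampleKernel M _ (measurable_one.indicator hu), Nat.add_sub_cancel]

theorem integral_norm_momentumError_succ_sq_le
    (hrun : IsSharpRun M pol H T θ₀ α₀ η₀ μ ℱ θ v b τ τb) (hr : M.BoundedReward R₀)
    (hpol : pol.Regular G L) (hα₀ : 0 ≤ α₀) (hα₀' : α₀ ≤ 1) (hη₀ : 0 ≤ η₀) {t : ℕ}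
    (ht : t + 1 < T) :
    ∫ ω, ‖M.momentumError pol H θ v (t + 1) ω‖ ^ 2 ∂μ ≤
      (1 - sharpAlpha α₀ (t + 1)) ^ 2 * ∫ ω, ‖M.momentumError pol H θ v t ω‖ ^ 2 ∂μ +
      ((1 - sharpAlpha α₀ (t + 1)) * (2 * M.sigmaB H R₀ G L * sharpEta η₀ t) +
        sharpAlpha α₀ (t + 1) * M.sigmaG R₀ G) ^ 2 := by
  set α := sharpAlpha α₀ (t + 1)
  set D := (1 - α) * (2 * M.sigmaB H R₀ G L * sharpEta η₀ t) + α * M.sigmaG R₀ G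
  set e := M.momentumError pol H θ v t
  have hem : Measurable[ℱ t] e := hrun.measurable_momentumError hr hpol (by omega)
  have hV : Measurable fun ω => (e ω, θ (t + 1) ω, θ t ω) :=
    (hem.prodMk ((hrun.measurable_theta_succ hpol (by omega)).prodMk
      (hrun.measurable_theta_and_v hpol (by omega)).1)).mono (ℱ.le _) le_rfl
  have hX : Measurable fun ω => (b (t + 1) ω, τ (t + 1) ω, τb (t + 1) ω) :=
    (hrun.measurable_sample_succ ht).mono (ℱ.le _) le_rfl
  have hperm : Measurable fun z : (EuclideanSpace ℝ (Fin d) × EuclideanSpace ℝ (Fin d) ×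
      EuclideanSpace ℝ (Fin d)) × (ℝ × Traj S A H × Traj S A H) => (z.1.2, z.2) := by fun_prop
  have hscaled : StronglyMeasurable fun w : EuclideanSpace ℝ (Fin d) × EuclideanSpace ℝ (Fin d) ×
      EuclideanSpace ℝ (Fin d) => (1 - α) • w.1 :=
    stronglyMeasurable_id.fst.const_smul (1 - α)
  have hZ := (M.stronglyMeasurable_sharpIncrement (H := H) hpol α).comp_measurable hperm
  have he : MemLp (fun ω => (1 - α) • e ω) 2 μ :=
    MemLp.const_smul (hrun.memLp_momentumError hr hpol hα₀ hα₀' hη₀ (by omega)) (1 - α)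
  have hclose : ∀ᵐ w ∂μ.map fun ω => (e ω, θ (t + 1) ω, θ t ω),
      ‖w.2.1 - w.2.2‖ ≤ sharpEta η₀ t :=
    (ae_map_iff hV.aemeasurable (measurableSet_le (by fun_prop) measurable_const)).2
      (.of_forall (hrun.norm_theta_succ_sub_le hη₀ (by omega)))
  have hbound : ∀ᵐ w ∂μ.map fun ω => (e ω, θ (t + 1) ω, θ t ω),
      ∀ y : ℝ × Traj S A H × Traj S A H, ‖M.sharpIncrement pol α w.2 y‖ ≤ D :=
    hclose.mono fun w hw y => norm_sharpIncrement_le hr hpol (sharpAlpha_nonneg hα₀ _)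
      (sharpAlpha_succ_le_one hα₀' t) hw y
  calc ∫ ω, ‖M.momentumError pol H θ v (t + 1) ω‖ ^ 2 ∂μ
      ≤ ∫ ω, ‖(1 - α) • e ω‖ ^ 2 ∂μ + D ^ 2 := by
        simp only [hrun.momentumError_succ hr hpol ht]
        exact integral_norm_add_sub_integral_sq_le_of_map_eq_compProd
          (u := fun w => (1 - α) • w.1) (Z := fun z => M.sharpIncrement pol α z.1.2 z.2) hV hX
          (hrun.map_prodMk_sample_succ hpol ht hem) hscaled he hZ hbound
    _ = (1 - α) ^ 2 * ∫ ω, ‖e ω‖ ^ 2 ∂μ + D ^ 2 := by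
        simp only [norm_smul, mul_pow, integral_const_mul, Real.norm_eq_abs, sq_abs]

theorem integral_norm_momentumError_sq_le_sharpC_div
    (hrun : IsSharpRun M pol H T θ₀ α₀ η₀ μ ℱ θ v b τ τb) (hr : M.BoundedReward R₀)
    (hpol : pol.Regular G L) (hα₀ : 2 / 3 < α₀) (hα₀' : α₀ ≤ 1) (hη₀ : 0 ≤ η₀) {t : ℕ}
    (ht : 1 ≤ t) (htT : t < T) :
    ∫ ω, ‖M.momentumError pol H θ v t ω‖ ^ 2 ∂μ ≤
      sharpC α₀ η₀ (M.sigmaG R₀ G) (M.sigmaB H R₀ G L) / (t : ℝ) ^ ((2 : ℝ) / 3) := by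
  have hzero : ∫ ω, ‖M.momentumError pol H θ v 0 ω‖ ^ 2 ∂μ ≤ 4 * M.sigmaG R₀ G ^ 2 := by
    have hconst : ∫ _ : Ω, (2 * M.sigmaG R₀ G) ^ 2 ∂μ = 4 * M.sigmaG R₀ G ^ 2 := by
      rw [integral_const, probReal_univ, one_smul]
      ring
    rw [← hconst]
    exact integral_mono_of_nonneg (.of_forall fun _ => by positivity) (integrable_const _)
      (.of_forall fun ω => pow_le_pow_left₀ (norm_nonneg _)
        (hrun.norm_momentumError_zero_le hr hpol ω) 2)
  exact le_sharpC_div_of_recursion (a := fun t => ∫ ω, ‖M.momentumError pol H θ v t ω‖ ^ 2 ∂μ)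
    hα₀ hα₀' hη₀ (fun _ => integral_nonneg fun _ => by positivity) hzero
    (fun _ ht => hrun.integral_norm_momentumError_succ_sq_le hr hpol (by linarith) hα₀' hη₀ ht)
    ht htT

theorem integral_norm_momentumError_le
    (hrun : IsSharpRun M pol H T θ₀ α₀ η₀ μ ℱ θ v b τ τb) (hr : M.BoundedReward R₀)
    (hpol : pol.Regular G L) (hα₀ : 2 / 3 < α₀) (hα₀' : α₀ ≤ 1) (hη₀ : 0 ≤ η₀) {t : ℕ}
    (ht : 1 ≤ t) (htT : t < T) :
    ∫ ω, ‖M.momentumError pol H θ v t ω‖ ∂μ ≤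
      √(sharpC α₀ η₀ (M.sigmaG R₀ G) (M.sigmaB H R₀ G L)) * (t : ℝ) ^ ((2 : ℝ) / 3 - 1) := by
  have ht₀ : (0 : ℝ) ≤ t := t.cast_nonneg
  refine (integral_norm_le_sqrt_integral_norm_sq
    (hrun.memLp_momentumError hr hpol (by linarith) hα₀' hη₀ htT)).trans ((Real.sqrt_le_sqrt
      (hrun.integral_norm_momentumError_sq_le_sharpC_div hr hpol hα₀ hα₀' hη₀ ht htT)).trans
        (le_of_eq ?_))
  rw [Real.sqrt_div' _ (Real.rpow_nonneg ht₀ _), Real.sqrt_eq_rpow (_ ^ _), ← Real.rpow_mul ht₀,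
    div_eq_mul_inv, ← Real.rpow_neg ht₀]
  norm_num

lemma integrable_norm_gradient_J (hrun : IsSharpRun M pol H T θ₀ α₀ η₀ μ ℱ θ v b τ τb)
    (hr : M.BoundedReward R₀) (hpol : pol.Regular G L) {t : ℕ} (ht : t ∈ Finset.Icc 1 T) :
    Integrable (fun ω => ‖gradient (M.J pol H) (θ t ω)‖) μ := by
  obtain ⟨s, rfl⟩ := Nat.exists_eq_add_of_le' (Finset.mem_Icc.1 ht).1
  have hmeas := (lipschitzWith_gradient_J (H := H) hr hpol).continuous.measurable.comp
    ((hrun.measurable_theta_succ hpol (Finset.mem_Icc.1 ht).2).mono (ℱ.le s) le_rfl)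
  exact (Integrable.of_bound hmeas.aestronglyMeasurable _
    (.of_forall fun ω => norm_gradient_J_le hr hpol _)).norm

theorem sum_integral_norm_momentumError_le
    (hrun : IsSharpRun M pol H T θ₀ α₀ η₀ μ ℱ θ v b τ τb) (hr : M.BoundedReward R₀)
    (hpol : pol.Regular G L) (hα₀ : 2 / 3 < α₀) (hα₀' : α₀ ≤ 1) (hη₀ : 0 ≤ η₀) :
    ∑ t ∈ Finset.Ico 1 T, ∫ ω, ‖M.momentumError pol H θ v t ω‖ ∂μ ≤
      3 / 2 * √(sharpC α₀ η₀ (M.sigmaG R₀ G) (M.sigmaB H R₀ G L)) *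
        (T : ℝ) ^ ((2 : ℝ) / 3) := by
  set C := sharpC α₀ η₀ (M.sigmaG R₀ G) (M.sigmaB H R₀ G L)
  calc ∑ t ∈ Finset.Ico 1 T, ∫ ω, ‖M.momentumError pol H θ v t ω‖ ∂μ
      ≤ √C * ∑ t ∈ Finset.Ico 1 T, (t : ℝ) ^ ((2 : ℝ) / 3 - 1) := by
        rw [Finset.mul_sum]
        exact Finset.sum_le_sum fun t ht => hrun.integral_norm_momentumError_le hr hpol hα₀ hα₀'
          hη₀ (Finset.mem_Ico.1 ht).1 (Finset.mem_Ico.1 ht).2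
    _ ≤ √C * ((T : ℝ) ^ ((2 : ℝ) / 3) / (2 / 3)) := by
        gcongr
        exact sum_Ico_rpow_sub_one_le (by norm_num) (by norm_num) T
    _ = 3 / 2 * √C * (T : ℝ) ^ ((2 : ℝ) / 3) := by ring

theorem integral_sum_norm_gradient_J_le
    (hrun : IsSharpRun M pol H T θ₀ α₀ η₀ μ ℱ θ v b τ τb) (hr : M.BoundedReward R₀)
    (hpol : pol.Regular G L) (hα₀ : 2 / 3 < α₀) (hα₀' : α₀ ≤ 1) (hη₀ : 0 < η₀) (hT : 1 ≤ T) :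
    ∫ ω, ∑ t ∈ Finset.Icc 1 T, ‖gradient (M.J pol H) (θ t ω)‖ ∂μ ≤
      (4 * √(sharpC α₀ η₀ (M.sigmaG R₀ G) (M.sigmaB H R₀ G L)) +
        2 * (|R₀| / (1 - M.γ)) / η₀) * (T : ℝ) ^ ((2 : ℝ) / 3) +
      6 * M.sigmaB H R₀ G L * η₀ * (T : ℝ) ^ ((1 : ℝ) / 3) := by
  set C := sharpC α₀ η₀ (M.sigmaG R₀ G) (M.sigmaB H R₀ G L)
  set a := 2 * (|R₀| / (1 - M.γ)) / η₀ * (T : ℝ) ^ ((2 : ℝ) / 3)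
  set c := 6 * M.sigmaB H R₀ G L * η₀ * (T : ℝ) ^ ((1 : ℝ) / 3)
  have herror : ∀ t ∈ Finset.Ico 1 T,
      Integrable (fun ω => ‖M.momentumError pol H θ v t ω‖) μ := fun t ht =>
    ((hrun.memLp_momentumError hr hpol (by linarith) hα₀' hη₀.le
      (Finset.mem_Ico.1 ht).2).integrable one_le_two).norm
  have hsum := integrable_finsetSum _ herror
  have hpath (ω : Ω) : ∑ t ∈ Finset.Icc 1 T, ‖gradient (M.J pol H) (θ t ω)‖ ≤
      2 * ∑ t ∈ Finset.Ico 1 T, ‖M.momentumError pol H θ v t ω‖ +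
        (a + c + M.sigmaG R₀ G) := by
    rw [← Finset.sum_Ico_add_eq_sum_Icc hT]
    linarith [hrun.sum_Ico_norm_gradient_J_le hr hpol hη₀ hT ω,
      norm_gradient_J_le (H := H) hr hpol (θ T ω)]
  have hmean := integral_mono
    (integrable_finsetSum _ fun t ht => hrun.integrable_norm_gradient_J hr hpol ht)
    ((hsum.const_mul 2).add (integrable_const (a + c + M.sigmaG R₀ G))) hpath
  rw [integral_add' (hsum.const_mul 2) (integrable_const _), integral_const_mul,
    integral_finsetSum _ herror, integral_const, probReal_univ, one_smul] at hmean
  have hσ : M.sigmaG R₀ G ≤ √C * (T : ℝ) ^ ((2 : ℝ) / 3) :=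
    (le_sqrt_sharpC hα₀ hα₀').trans (le_mul_of_one_le_right (Real.sqrt_nonneg _)
      (Real.one_le_rpow (by exact_mod_cast hT) (by norm_num)))
  linarith [hrun.sum_integral_norm_momentumError_le hr hpol hα₀ hα₀' hη₀.le]

end IsSharpRun

lemma one_div_mul_add_mul_rpow {x : ℝ} (hx : 0 < x) (a c : ℝ) :
    1 / x * (a * x ^ ((2 : ℝ) / 3) + c * x ^ ((1 : ℝ) / 3)) =
      a / x ^ ((1 : ℝ) / 3) + c / x ^ ((2 : ℝ) / 3) := by
  have hinv (p : ℝ) : x ^ (1 - p) / x = (x ^ p)⁻¹ := by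
    rw [← Real.rpow_sub_one hx.ne', sub_sub_cancel_left, Real.rpow_neg hx.le]
  have h₁ := hinv (1 / 3)
  have h₂ := hinv (2 / 3)
  norm_num at h₁ h₂
  rw [div_eq_mul_inv a, div_eq_mul_inv c, ← h₁, ← h₂]
  ring

theorem theorem1 {S A Ω : Type*} [MeasurableSpace S] [MeasurableSpace A] [mΩ : MeasurableSpace Ω]
    {d : ℕ} {ν : Measure A} [SigmaFinite ν] (M : MDP S A) (pol : ParamPolicy S A d ν) (H : ℕ)
    (R₀ G L : ℝ) (hR₀ : 0 < R₀) (hG : 0 < G) (hL : 0 < L)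
    (hreward : M.BoundedReward R₀) (hpol : pol.Regular G L)
    (α₀ η₀ : ℝ) (hα₀ : 2 / 3 < α₀) (hα₀' : α₀ ≤ 1) (hη₀ : 0 < η₀)
    (T : ℕ) (hT : 1 ≤ T) (θ₀ : EuclideanSpace ℝ (Fin d))
    (μ : Measure Ω) [IsProbabilityMeasure μ] (ℱ : Filtration ℕ mΩ)
    (θ v : ℕ → Ω → EuclideanSpace ℝ (Fin d)) (b : ℕ → Ω → ℝ) (τ τb : ℕ → Ω → Traj S A H)
    (hrun : IsSharpRun M pol H T θ₀ α₀ η₀ μ ℱ θ v b τ τb) :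
    Differentiable ℝ (M.J pol H) ∧
    Integrable (fun ω => (1 / (T : ℝ)) *
      ∑ t ∈ Finset.Icc 1 T, ‖gradient (M.J pol H) (θ t ω)‖) μ ∧
    ∫ ω, (1 / (T : ℝ)) * ∑ t ∈ Finset.Icc 1 T, ‖gradient (M.J pol H) (θ t ω)‖ ∂μ ≤
      (8 * Real.sqrt (sharpC α₀ η₀ (M.sigmaG R₀ G) (M.sigmaB H R₀ G L))
          + 9 * (R₀ / (1 - M.γ)) / η₀) / (T : ℝ) ^ ((1 : ℝ) / 3)
        + 6 * M.sigmaB H R₀ G L * η₀ / (T : ℝ) ^ ((2 : ℝ) / 3) := by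
  have hCJ : 0 ≤ R₀ / (1 - M.γ) := div_nonneg hR₀.le (sub_nonneg.2 M.γ_lt_one.le)
  have hsum := hrun.integral_sum_norm_gradient_J_le hreward hpol hα₀ hα₀' hη₀ hT
  rw [abs_of_pos hR₀] at hsum
  refine ⟨MDP.differentiable_J hreward hpol, (integrable_finsetSum _ fun t ht =>
    hrun.integrable_norm_gradient_J hreward hpol ht).const_mul _, ?_⟩
  rw [integral_const_mul]
  set C := sharpC α₀ η₀ (M.sigmaG R₀ G) (M.sigmaB H R₀ G L)
  calc 1 / (T : ℝ) * ∫ ω, ∑ t ∈ Finset.Icc 1 T, ‖gradient (M.J pol H) (θ t ω)‖ ∂μ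
      ≤ 1 / (T : ℝ) * ((4 * √C + 2 * (R₀ / (1 - M.γ)) / η₀) * (T : ℝ) ^ ((2 : ℝ) / 3) +
          6 * M.sigmaB H R₀ G L * η₀ * (T : ℝ) ^ ((1 : ℝ) / 3)) := by gcongr
    _ = (4 * √C + 2 * (R₀ / (1 - M.γ)) / η₀) / (T : ℝ) ^ ((1 : ℝ) / 3) +
          6 * M.sigmaB H R₀ G L * η₀ / (T : ℝ) ^ ((2 : ℝ) / 3) :=
        one_div_mul_add_mul_rpow (by exact_mod_cast hT) _ _
    _ ≤ _ := by gcongr <;> norm_num
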